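/- Fix a dimension $d\ge 2$ and a real exponent $p$ with $\frac4d\le p<\frac4{d-2}$ (only $p\ge 2$ if $d=2$), and let $s_c=\frac d2-\frac2p\in[0,1)$. Here $\dot H^s=\dot H^s(\mathbb R^d)$ consists of the tempered complex-valued functions $f$, modulo null functions, whose distributional Fourier transform $\hat f(\xi)=\int e^{-2\pi i x\cdot\xi}f(x)\,dx$ is a locally integrable function with $\|f\|_{\dot H^s}^2=\int(2\pi|\xi|)^{2s}|\hat f(\xi)|^2\,d\xi<\infty$, and $\dot H^1\cap\dot H^{s_c}$ is normed by $\|\cdot\|_{\dot H^1}+\|\cdot\|_{\dot H^{s_c}}$. Let $\{f_n\}_{n\ge1}$ be a bounded sequence in $\dot H^1\cap\dot H^{s_c}$. Then there exist $J^*\in\{0,1,2,\dots\}\cup\{\infty\}$, nonzero functions $\{\phi^j\}_{j=1}^{J^*}\subset\dot H^1\cap\dot H^{s_c}$ (real-valued if all the $f_n$ are), points $\{x_n^j\}_{j=1}^{J^*}\subset\mathbb R^d$, and a subsequence of $\{f_n\}$ such that along this subsequence $$f_n(x)=\sum_{j=1}^J\phi^j(x-x_n^j)+r_n^J(x)\qquad\text{for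 each integer } 0\le J<J^*+1,$$ where $\phi^j$ and $r_n^J$ lie in $\dot H^1\cap\dot H^{s_c}\cap L^{p+2}$, and $$r_n^J(\cdot+x_n^J)\rightharpoonup0\quad\text{weakly in }\dot H^1\cap\dot H^{s_c}\text{ as } n\to\infty,\qquad\text{for each integer } 1\le J<J^*+1.$$ Furthermore, along this subsequence, $$\lim_{J\to J^*}\limsup_{n\to\infty}\|r_n^J\|_{L^{p+2}}=0$$ (for finite $J^*$ this means that $\limsup_{n\to\infty}\|r_n^{J^*}\|_{L^{p+2}}=0$), and for each integer $0\le J<J^*+1$, $$\lim_{n\to\infty}\Bigl\{\|f_n\|_{\dot H^1}^2-\Bigl[\sum_{j=1}^J\|\phi^j\|_{\dot H^1}^2+\|r_n^J\|_{\dot H^1}^2\Bigr]\Bigr\}=0,$$ $$\lim_{n\to\infty}\Bigl\{\|f_n\|_{\dot H^{s_c}}^2-\Bigl[\sum_{j=1}^J\|\phi^j\|_{\dot H^{s_c}}^2+\|r_n^J\|_{\dot H^{s_c}}^2\Bigr]\Bigr\}=0,$$ $$\lim_{n\to\infty}\Bigl\{\|f_n\|_{L^{p+2}}^{p+2}-\Bigl[\sum_{j=1}^J\|\phi^j\|_{L^{p+2}}^{p+2}+\|r_n^J\|_{L^{p+2}}^{p+2}\Bigr]\Bigr\}=0.$$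 Finally, $\lim_{n\to\infty}|x_n^j-x_n^{j'}|=\infty$ for all $j\ne j'$. -/

import Mathlib

open MeasureTheory Filter Topology
open scoped SchwartzMap ENNReal FourierTransform

noncomputable section

namespace Bubble

/-- The space `ℝ^d`. -/
abbrev Rd (d : ℕ) : Type := EuclideanSpace ℝ (Fin d)

/-- The tempered distribution `T` is given by integration against the function `f`. (Integrability
against all Schwartz functions forces `f` to be a.e.-measurable and locally integrable.) -/
def Represents {d : ℕ} (T : 𝓢'(Rd d, ℂ)) (f : Rd d → ℂ) : Prop :=
  ∀ ψ : 𝓢(Rd d, ℂ), Integrable (fun x => ψ x * f x) ∧ T ψ = ∫ x, ψ x * f x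

/-- The functions `f` and `g` are tempered, and `g` is the Fourier transform of `f` in the sense of
tempered distributions. -/
def IsFourierTransform {d : ℕ} (f g : Rd d → ℂ) : Prop :=
  ∃ T : 𝓢'(Rd d, ℂ), Represents T f ∧ Represents (𝓕 T) g

open Classical in
/-- The Fourier transform of `f`, as a function (unique up to null sets where it exists). -/
def fourierFn {d : ℕ} (f : Rd d → ℂ) : Rd d → ℂ :=
  if h : ∃ g, IsFourierTransform f g then h.choose else 0

/-- The symbol of `|∇|^s f`. Mathlib's Fourier transform has kernel `exp (-2πi⟨x, ξ⟩)`, so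
that `|∇|` has the symbol `2π|ξ|`. -/
def weighted {d : ℕ} (s : ℝ) (g : Rd d → ℂ) : Rd d → ℂ :=
  fun ξ => (((2 * Real.pi * ‖ξ‖) ^ s : ℝ) : ℂ) * g ξ

/-- Membership in the homogeneous Sobolev space `Ḣ^s(ℝ^d)`: the Fourier transform of `f` is a
locally integrable function, and `|∇|^s f` is in `L²`. -/
def MemHdot {d : ℕ} (s : ℝ) (f : Rd d → ℂ) : Prop :=
  ∃ g, IsFourierTransform f g ∧ MemLp (weighted s g) 2 volume

/-- The norm `‖f‖_{Ḣ^s} = ‖|∇|^s f‖_{L²}`, computed on the Fourier side. -/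
def hdotNorm {d : ℕ} (s : ℝ) (f : Rd d → ℂ) : ℝ :=
  (eLpNorm (weighted s (fourierFn f)) 2 volume).toReal

/-- Membership in `Ḣ^1 ∩ Ḣ^s`. -/
def MemX {d : ℕ} (s : ℝ) (f : Rd d → ℂ) : Prop :=
  MemHdot 1 f ∧ MemHdot s f

/-- Weak convergence in the normed space `Ḣ^1 ∩ Ḣ^s`, normed by `‖·‖_{Ḣ^1} + ‖·‖_{Ḣ^s}`:
convergence under every bounded linear functional on the space. A linear functional on the space
is written as the restriction of a linear functional on all functions; such
an extension always exists, and only its values on the space matter. -/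
def WeakTendsto {d : ℕ} (s : ℝ) (u : ℕ → Rd d → ℂ) (v : Rd d → ℂ) : Prop :=
  (∀ n, MemX s (u n)) ∧ MemX s v ∧
  ∀ ℓ : (Rd d → ℂ) →ₗ[ℂ] ℂ,
    (∃ C : ℝ, ∀ f, MemX s f → ‖ℓ f‖ ≤ C * (hdotNorm 1 f + hdotNorm s f)) →
    Tendsto (fun n => ℓ (u n)) atTop (𝓝 (ℓ v))

/-- The filter of natural numbers `J` tending to `Jstar ∈ {0, 1, …} ∪ {∞}`: it is `atTop` if
`Jstar = ∞`, and `J = Jstar` if `Jstar` is finite. -/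
def toJstar (Jstar : ℕ∞) : Filter ℕ :=
  comap (fun J : ℕ => (J : ℕ∞)) (𝓝 Jstar)

end Bubble

end

/-! Multiplying the Fourier transform by `2π|ξ| + (2π|ξ|)^s` identifies `Ḣ^1 ∩ Ḣ^s` with `L²`. A
function is replaced by its amplitude `h`, translations become the isometries `shift`, and both
Sobolev norms become norms of bounded multipliers of `h` that commute with translations. The theorem
then separates into a Hilbert space argument and a few facts about `L^q`, `q = p + 2`.

Hilbert space: let the action be isometric and strongly continuous, with matrix coefficients
vanishing at infinity (here by Riemann–Lebesgue). Profiles are extracted greedily. Each is a weak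
limit of translates of the current remainder whose norm is at least half of the largest possible. By
Pythagoras the squared norms are summable, so the profiles tend to zero, and mixing forces the
centres apart. All limits are taken along a nonprincipal ultrafilter, where compactness provides
them; a subsequence realising the countably many limits in use is chosen only at the end
(`exists_hilbert_profile_decomposition`).

Analysis: `Ḣ^σ ⊆ L^q` with `s < σ < 1`, and the strict inequalities make very low and very high
frequencies negligible. On the remaining band the function is itself a matrix coefficient `x ↦ ⟪χ,
shift x h⟫`. If it is not small in `L^q`, this coefficient is large somewhere
(`exists_concentration`), so a remainder that is not small yields a profile of definite size; hence
the remainders vanish in `L^q`. The same representation turns weak convergence into local strong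
convergence, from which follow the Brezis–Lieb splitting and the reality of the profiles. -/

noncomputable section

namespace Bubble

/-! ### Weak limits along ultrafilters and extraction of subsequences. -/

section WeakLimits

variable {H : Type*} [NormedAddCommGroup H] [InnerProductSpace ℂ H]

/-- Weak convergence of a sequence along a filter in a Hilbert space. -/
def WeakLim (l : Filter ℕ) (u : ℕ → H) (φ : H) : Prop :=
  ∀ k : H, Tendsto (fun n => inner ℂ k (u n)) l (𝓝 (inner ℂ k φ))

theorem WeakLim.sub {l : Filter ℕ} {u v : ℕ → H} {φ ψ : H} (hu : WeakLim l u φ)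
    (hv : WeakLim l v ψ) : WeakLim l (fun n => u n - v n) (φ - ψ) := by
  intro k
  simpa only [inner_sub_right] using (hu k).sub (hv k)

theorem weakLim_const (l : Filter ℕ) (φ : H) : WeakLim l (fun _ => φ) φ :=
  fun _ => tendsto_const_nhds

/-- Banach–Alaoglu through the Riesz isomorphism: an ultrafilter on a compact set converges. -/
theorem exists_weakLim_of_bounded [CompleteSpace H] (U : Ultrafilter ℕ) {u : ℕ → H} {C : ℝ}
    (hC : ∀ n, ‖u n‖ ≤ C) : ∃ φ, WeakLim U u φ := by
  let D : ℕ → WeakDual ℂ H := fun n => StrongDual.toWeakDual (InnerProductSpace.toDual ℂ H (u n))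
  have hK := WeakDual.isCompact_closedBall (𝕜 := ℂ) (0 : StrongDual ℂ H) C
  have hmem : ∀ n, D n ∈ WeakDual.toStrongDual ⁻¹' Metric.closedBall (0 : StrongDual ℂ H) C := by
    intro n
    simpa [D] using hC n
  obtain ⟨x, -, hx⟩ := hK.ultrafilter_le_nhds (U.map D)
    (le_principal_iff.2
      ((Eventually.of_forall hmem : ∀ᶠ n in (U : Filter ℕ), _ ∈ _)))
  have hx' : Tendsto D U (𝓝 x) := hx
  refine ⟨(InnerProductSpace.toDual ℂ H).symm (WeakDual.toStrongDual x), fun k => ?_⟩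
  have h1 := ((WeakDual.eval_continuous k).tendsto x).comp hx'
  -- `toDual` places `u n` in the conjugate-linear slot; conjugation restores the order.
  have h2 := (Complex.continuous_conj.tendsto _).comp h1
  convert h2 using 1
  · ext n
    simp only [Function.comp]
    exact (inner_conj_symm k (u n)).symm
  · congr 1
    rw [← inner_conj_symm]
    congr 1
    exact InnerProductSpace.toDual_symm_apply

theorem WeakLim.norm_le {l : Filter ℕ} [l.NeBot] {u : ℕ → H} {φ : H} (hu : WeakLim l u φ) {C : ℝ}
    (hC : ∀ᶠ n in l, ‖u n‖ ≤ C) : ‖φ‖ ≤ C := by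
  have h0 : 0 ≤ C := by
    obtain ⟨n, hn⟩ := hC.exists
    exact (norm_nonneg _).trans hn
  have h1 : ‖inner ℂ φ φ‖ ≤ ‖φ‖ * C := by
    refine le_of_tendsto (hu φ).norm ?_
    filter_upwards [hC] with n hn
    exact (norm_inner_le_norm _ _).trans (by gcongr)
  rw [inner_self_eq_norm_sq_to_K, norm_pow] at h1
  simp only [Complex.coe_algebraMap, Complex.norm_real, norm_norm] at h1
  rcases eq_or_lt_of_le (norm_nonneg φ) with h | h
  · rw [← h]; exact h0
  · nlinarith

/-- Reduces weak convergence to countably many scalar limits, which one subsequence can realise. -/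
theorem weakLim_of_dense {l : Filter ℕ} {u : ℕ → H} {C : ℝ}
    (hC : ∀ n, ‖u n‖ ≤ C) {D : ℕ → H} (hD : DenseRange D)
    (h : ∀ i, Tendsto (fun n => inner ℂ (D i) (u n)) l (𝓝 0)) : WeakLim l u 0 := by
  intro k
  rw [inner_zero_right, Metric.tendsto_nhds]
  intro ε hε
  obtain ⟨i, hi⟩ := Metric.denseRange_iff.1 hD k (ε / (2 * (|C| + 1))) (by positivity)
  filter_upwards [Metric.tendsto_nhds.1 (h i) (ε / 2) (by positivity)] with n hn
  rw [dist_zero_right] at hn ⊢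
  have h1 : inner ℂ k (u n) = inner ℂ (k - D i) (u n) + inner ℂ (D i) (u n) := by
    rw [inner_sub_left]; ring
  have h2 : ‖inner ℂ (k - D i) (u n)‖ ≤ ε / (2 * (|C| + 1)) * (|C| + 1) := by
    refine (norm_inner_le_norm _ _).trans ?_
    rw [dist_eq_norm] at hi
    have := (hC n).trans (le_abs_self C)
    gcongr
    linarith
  have h3 : ε / (2 * (|C| + 1)) * (|C| + 1) = ε / 2 := by
    have : |C| + 1 ≠ 0 := by positivity
    field_simp
  rw [h1]
  refine (norm_add_le _ _).trans_lt ?_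
  linarith

/-- Replaces a diagonal argument. A countable infimum of countably generated filters is countably
generated, and it is proper because `U` lies below it. -/
theorem exists_strictMono_tendsto_of_ultrafilter {U : Ultrafilter ℕ} (hU : (U : Filter ℕ) ≤ atTop)
    (F : ℕ → Filter ℕ) [∀ i, (F i).IsCountablyGenerated] (hF : ∀ i, (U : Filter ℕ) ≤ F i) :
    ∃ σ : ℕ → ℕ, StrictMono σ ∧ ∀ i, Tendsto σ atTop (F i) := by
  have hle : (U : Filter ℕ) ≤ atTop ⊓ ⨅ i, F i := le_inf hU (le_iInf hF)
  have : (atTop ⊓ ⨅ i, F i).NeBot := NeBot.mono U.neBot hle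
  obtain ⟨x, hx⟩ := exists_seq_tendsto (atTop ⊓ ⨅ i, F i)
  rw [tendsto_inf, tendsto_iInf] at hx
  obtain ⟨ψ, hψ, hm⟩ := strictMono_subseq_of_tendsto_atTop hx.1
  exact ⟨x ∘ ψ, hm, fun i => (hx.2 i).comp hψ.tendsto_atTop⟩

end WeakLimits

/-! ### Mixing isometric actions and greedy extraction of profiles. -/

section Abstract

variable {V H : Type*} [NormedAddCommGroup V]
  [NormedAddCommGroup H] [InnerProductSpace ℂ H]

/-- A strongly continuous isometric action of `V` on `H` all of whose matrix coefficients vanish at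
infinity. -/
structure IsMixingAction (τ : V → H →ₗᵢ[ℂ] H) : Prop where
  zero : ∀ h, τ 0 h = h
  add : ∀ a b h, τ (a + b) h = τ a (τ b h)
  cont : ∀ h, Continuous fun a => τ a h
  vanish : ∀ k h, Tendsto (fun a => inner ℂ k (τ a h)) (cocompact V) (𝓝 0)

variable {τ : V → H →ₗᵢ[ℂ] H}

theorem IsMixingAction.neg_apply (hτ : IsMixingAction τ) (a : V) (h : H) : τ a (τ (-a) h) = h := by
  rw [← hτ.add, add_neg_cancel, hτ.zero]

theorem IsMixingAction.inner_right (hτ : IsMixingAction τ) (a : V) (k h : H) :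
    inner ℂ k (τ a h) = inner ℂ (τ (-a) k) h := by
  conv_lhs => rw [← hτ.neg_apply a k]
  exact (τ a).inner_map_map _ _

/-- If the relative translations did not escape, they would converge along `U` to some `b`. By
strong continuity, translating by `y n` would be translating by `x n` and then almost by `b`, so `φ`
would be the `b`-translate of zero. -/
theorem IsMixingAction.tendsto_cocompact (hτ : IsMixingAction τ) {U : Ultrafilter ℕ}
    {r : ℕ → H} {C : ℝ} (hr : ∀ n, ‖r n‖ ≤ C) {x y : ℕ → V} {φ : H}
    (hx : WeakLim U (fun n => τ (x n) (r n)) 0)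
    (hy : WeakLim U (fun n => τ (y n) (r n)) φ) (hφ : φ ≠ 0) :
    Tendsto (fun n => y n - x n) U (cocompact V) := by
  by_contra hcon
  rw [(hasBasis_cocompact).tendsto_right_iff] at hcon
  push Not at hcon
  obtain ⟨K, hK, hKf⟩ := hcon
  -- Along an ultrafilter, not being eventually outside `K` means being eventually inside.
  have hev : ∀ᶠ n in (U : Filter ℕ), y n - x n ∈ K := by
    filter_upwards [hKf] with n hn
    simpa using hn
  obtain ⟨b, -, hb⟩ := hK.ultrafilter_le_nhds (U.map fun n => y n - x n)
    (le_principal_iff.2 hev)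
  have hb' : Tendsto (fun n => y n - x n) U (𝓝 b) := hb
  apply hφ
  rw [← inner_self_eq_zero (𝕜 := ℂ)]
  refine tendsto_nhds_unique (hy φ) ?_
  have h1 : ∀ n, inner ℂ φ (τ (y n) (r n)) =
      inner ℂ (τ (-b) φ) (τ (x n) (r n)) +
        inner ℂ (τ (-(y n - x n)) φ - τ (-b) φ) (τ (x n) (r n)) := by
    intro n
    rw [inner_sub_left, add_sub_cancel, ← hτ.inner_right, ← hτ.add, sub_add_cancel]
  simp_rw [h1]
  have h2 := hx (τ (-b) φ)
  rw [inner_zero_right] at h2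
  have h3 : Tendsto (fun n => inner ℂ (τ (-(y n - x n)) φ - τ (-b) φ) (τ (x n) (r n))) U (𝓝 0) := by
    have h4 : Tendsto (fun n => τ (-(y n - x n)) φ - τ (-b) φ) U (𝓝 0) := by
      have := (((hτ.cont φ).comp continuous_neg).tendsto b).comp hb'
      simpa using this.sub_const (τ (-b) φ)
    have h5 := h4.norm.mul_const C
    rw [norm_zero, zero_mul] at h5
    refine squeeze_zero_norm (fun n => ?_) h5
    refine (norm_inner_le_norm _ _).trans ?_
    rw [LinearIsometry.norm_map]
    exact mul_le_mul_of_nonneg_left (hr n) (norm_nonneg _)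
  simpa using h2.add h3

theorem IsMixingAction.weakLim_zero (hτ : IsMixingAction τ) {l : Filter ℕ} {x : ℕ → V}
    (hx : Tendsto x l (cocompact V)) (φ : H) : WeakLim l (fun n => τ (x n) φ) 0 := by
  intro k
  rw [inner_zero_right]
  exact (hτ.vanish k φ).comp hx

/-- The supremum of the norms of weak limits need not be attained, but a limit above half of it
exists. If the supremum vanishes, every limit is zero and any choice serves. -/
theorem exists_near_maximal_profile [CompleteSpace H] (τ : V → H →ₗᵢ[ℂ] H) (U : Ultrafilter ℕ)
    {r : ℕ → H} (hr : ∃ C, ∀ n, ‖r n‖ ≤ C) :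
    ∃ (x : ℕ → V) (φ : H), WeakLim U (fun n => τ (x n) (r n)) φ ∧
      ∀ (y : ℕ → V) ψ, WeakLim U (fun n => τ (y n) (r n)) ψ → ‖ψ‖ ≤ 2 * ‖φ‖ := by
  obtain ⟨C, hC⟩ := hr
  let S : Set ℝ := {t | ∃ (x : ℕ → V) (φ : H), WeakLim U (fun n => τ (x n) (r n)) φ ∧ t = ‖φ‖}
  have hne : S.Nonempty := by
    obtain ⟨φ, hφ⟩ := exists_weakLim_of_bounded U (u := fun n => τ 0 (r n)) (C := C)
      (by simpa using hC)
    exact ⟨_, fun _ => 0, φ, hφ, rfl⟩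
  have hbd : BddAbove S := by
    refine ⟨C, ?_⟩
    rintro t ⟨x, φ, hφ, rfl⟩
    exact hφ.norm_le (Eventually.of_forall (by simpa using hC))
  by_cases h0 : sSup S ≤ 0
  · obtain ⟨t, x, φ, hφ, rfl⟩ := hne
    refine ⟨x, φ, hφ, fun y ψ hψ => ?_⟩
    have := (le_csSup hbd ⟨y, ψ, hψ, rfl⟩).trans h0
    linarith [norm_nonneg φ]
  · push Not at h0
    obtain ⟨t, ⟨x, φ, hφ, rfl⟩, ht⟩ := exists_lt_of_lt_csSup hne (half_lt_self h0)
    refine ⟨x, φ, hφ, fun y ψ hψ => ?_⟩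
    have := le_csSup hbd ⟨y, ψ, hψ, rfl⟩
    linarith

theorem exists_profile_sequence [CompleteSpace H] (τ : V → H →ₗᵢ[ℂ] H) (U : Ultrafilter ℕ)
    {h : ℕ → H} (hh : ∃ C, ∀ n, ‖h n‖ ≤ C) :
    ∃ (Φ : ℕ → H) (X : ℕ → ℕ → V) (R : ℕ → ℕ → H), R 0 = h ∧
      (∀ J, ∃ C, ∀ n, ‖R J n‖ ≤ C) ∧
      (∀ J n, R (J + 1) n = R J n - τ (-(X (J + 1) n)) (Φ (J + 1))) ∧
      (∀ J, WeakLim U (fun n => τ (X (J + 1) n) (R J n)) (Φ (J + 1))) ∧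
      ∀ J (y : ℕ → V) ψ, WeakLim U (fun n => τ (y n) (R J n)) ψ → ‖ψ‖ ≤ 2 * ‖Φ (J + 1)‖ := by
  let S := {r : ℕ → H // ∃ C, ∀ n, ‖r n‖ ≤ C}
  choose x φ hφ hmax using fun r : S => exists_near_maximal_profile τ U r.2
  let next : S → S := fun r => ⟨fun n => r.1 n - τ (-(x r n)) (φ r), by
    obtain ⟨C, hC⟩ := r.2
    refine ⟨C + ‖φ r‖, fun n => (norm_sub_le _ _).trans ?_⟩
    rw [LinearIsometry.norm_map]
    gcongr
    exact hC n⟩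
  let R : ℕ → S := fun J => Nat.rec ⟨h, hh⟩ (fun _ r => next r) J
  -- Profile `j` is extracted from remainder `j - 1`; the entry at `0` plays no role.
  refine ⟨fun j => φ (R (j - 1)), fun j => x (R (j - 1)), fun J => (R J).1, rfl, fun J => (R J).2,
    fun J n => rfl, fun J => hφ _, fun J => hmax _⟩

end Abstract

theorem toJstar_coe (k : ℕ) : toJstar (k : ℕ∞) = pure k := by
  rw [toJstar, ENat.nhds_natCast, comap_pure]
  have : (fun J : ℕ => (J : ℕ∞)) ⁻¹' {(k : ℕ∞)} = {k} := by
    ext J; simp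
  rw [this, principal_singleton]

theorem toJstar_top : toJstar ⊤ ≤ atTop := by
  rw [← tendsto_id', atTop_basis.tendsto_right_iff]
  intro i _
  exact ⟨Set.Ici (i : ℕ∞), Ici_mem_nhds (by simp), fun J hJ => by simpa using hJ⟩

/-! ### Profile decomposition in a Hilbert space. -/

section Abstract

variable {V H : Type*} [NormedAddCommGroup V]
  [NormedAddCommGroup H] [InnerProductSpace ℂ H]

variable {τ : V → H →ₗᵢ[ℂ] H}

/-- Expand the square in the frame moved by `x n`; the cross term converges by testing the weak
limit against `φ` itself. -/
theorem norm_sq_sub_of_weakLim (hτ : IsMixingAction τ) {l : Filter ℕ} {r : ℕ → H} {x : ℕ → V}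
    {φ : H} (h : WeakLim l (fun n => τ (x n) (r n)) φ) :
    Tendsto (fun n => ‖r n‖ ^ 2 - ‖r n - τ (-(x n)) φ‖ ^ 2) l (𝓝 (‖φ‖ ^ 2)) := by
  have h1 : ∀ n, ‖r n‖ ^ 2 - ‖r n - τ (-(x n)) φ‖ ^ 2 =
      2 * (inner ℂ φ (τ (x n) (r n))).re - ‖φ‖ ^ 2 := by
    intro n
    have h2 : ‖r n - τ (-(x n)) φ‖ = ‖τ (x n) (r n) - φ‖ := by
      rw [← LinearIsometry.norm_map (τ (x n)), map_sub, hτ.neg_apply]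
    have h3 := norm_sub_sq (𝕜 := ℂ) (τ (x n) (r n)) φ
    rw [h2, h3, LinearIsometry.norm_map, ← inner_conj_symm]
    simp only [RCLike.conj_re, RCLike.re_to_complex]
    ring
  simp_rw [h1]
  have h4 := ((Complex.continuous_re.tendsto _).comp (h φ)).const_mul 2 |>.sub_const (‖φ‖ ^ 2)
  have h5 : (inner ℂ φ φ).re = ‖φ‖ ^ 2 := by
    rw [inner_self_eq_norm_sq_to_K]
    simp only [Complex.coe_algebraMap, ← Complex.ofReal_pow, Complex.ofReal_re]
  rw [h5, two_mul, add_sub_cancel_right] at h4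
  exact h4

/-- Profile decomposition of bounded sequences in a Hilbert space with a mixing action, with
remainders vanishing in the sense of a functional `N` that is controlled by concentration. -/
theorem exists_hilbert_profile_decomposition [ProperSpace V] [CompleteSpace H]
    [TopologicalSpace.SeparableSpace H] (hτ : IsMixingAction τ) (N : H → ℝ≥0∞)
    (hN : ∀ (M : ℝ) (ε : ℝ≥0∞), 0 < ε → ∃ (χ : H) (c : ℝ), 0 < c ∧ ∀ h, ‖h‖ ≤ M → ε ≤ N h →
      ∃ x, c ≤ ‖inner ℂ χ (τ x h)‖)
    {h : ℕ → H} (hh : ∃ C, ∀ n, ‖h n‖ ≤ C) :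
    ∃ (Jstar : ℕ∞) (Φ : ℕ → H) (X : ℕ → ℕ → V) (σ : ℕ → ℕ) (R : ℕ → ℕ → H),
      StrictMono σ ∧
      (∀ j : ℕ, 1 ≤ j → (j : ℕ∞) ≤ Jstar → Φ j ≠ 0) ∧
      (∀ n, R 0 n = h (σ n)) ∧
      (∀ J n, R (J + 1) n = R J n - τ (-(X (J + 1) n)) (Φ (J + 1))) ∧
      (∀ J, ∃ C, ∀ n, ‖R J n‖ ≤ C) ∧
      (∀ J, WeakLim atTop (fun n => τ (X (J + 1) n) (R (J + 1) n)) 0) ∧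
      Tendsto (fun J => limsup (fun n => N (R J n)) atTop) (toJstar Jstar) (𝓝 0) ∧
      (∀ j j' : ℕ, 1 ≤ j → (j : ℕ∞) ≤ Jstar → 1 ≤ j' → (j' : ℕ∞) ≤ Jstar → j ≠ j' →
        Tendsto (fun n => ‖X j n - X j' n‖) atTop atTop) := by
  let U : Ultrafilter ℕ := Filter.hyperfilter ℕ
  have hU : (U : Filter ℕ) ≤ atTop := Nat.hyperfilter_le_atTop
  obtain ⟨Φ, X, R, hR0, hRb, hRs, hRw, hRmax⟩ := exists_profile_sequence τ U hh
  -- the translated remainders converge weakly to zero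
  have hzero : ∀ J, WeakLim U (fun n => τ (X (J + 1) n) (R (J + 1) n)) 0 := by
    intro J
    have := (hRw J).sub (weakLim_const U (Φ (J + 1)))
    rw [sub_self] at this
    convert this using 2 with n
    rw [hRs, map_sub, hτ.neg_apply]
  -- orthogonality
  have hall : ∀ J j, 1 ≤ j → j ≤ J → WeakLim U (fun n => τ (X j n) (R J n)) 0 := by
    intro J
    induction J with
    | zero => intro j h1 h2; omega
    | succ J ih =>
      intro j h1 h2
      rcases Nat.eq_or_lt_of_le h2 with rfl | h3
      · exact hzero J
      have hj := ih j h1 (by omega)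
      -- A zero profile leaves the remainder unchanged. A nonzero one forces the centres apart, and
      -- then, by mixing, its translate is weakly invisible in the frame of `X j`.
      by_cases hΦ : Φ (J + 1) = 0
      · simpa [hRs, hΦ] using hj
      obtain ⟨C, hC⟩ := hRb J
      have hco := hτ.tendsto_cocompact hC hj (hRw J) hΦ
      have hco' : Tendsto (fun n => X j n - X (J + 1) n) U (cocompact V) := by
        have := (Homeomorph.neg V).isClosedEmbedding.tendsto_cocompact.comp hco
        refine this.congr fun n => ?_
        simp
      have := hj.sub (hτ.weakLim_zero hco' (Φ (J + 1)))
      rw [sub_zero] at this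
      convert this using 2 with n
      rw [hRs, map_sub, ← hτ.add, sub_eq_add_neg (X j n)]
  have horth : ∀ j k, 1 ≤ j → j < k → Φ k ≠ 0 →
      Tendsto (fun n => ‖X j n - X k n‖) U atTop := by
    intro j k h1 h2 h3
    obtain ⟨k, rfl⟩ : ∃ m, k = m + 1 := ⟨k - 1, by omega⟩
    obtain ⟨C, hC⟩ := hRb k
    have := tendsto_norm_cocompact_atTop.comp
      (hτ.tendsto_cocompact hC (hall k j h1 (by omega)) (hRw k) h3)
    refine this.congr fun n => ?_
    exact norm_sub_rev _ _
  -- norms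
  obtain ⟨C, hC⟩ := hh
  obtain ⟨a, ha⟩ : ∃ a, Tendsto (fun n => ‖h n‖ ^ 2) U (𝓝 a) := by
    obtain ⟨a, -, ha⟩ := (isCompact_Icc (a := (0 : ℝ)) (b := C ^ 2)).ultrafilter_le_nhds
      (U.map fun n => ‖h n‖ ^ 2) (le_principal_iff.2 ((Eventually.of_forall fun n =>
        ⟨sq_nonneg _, pow_le_pow_left₀ (norm_nonneg _) (hC n) 2⟩ :
          ∀ᶠ n in (U : Filter ℕ), ‖h n‖ ^ 2 ∈ Set.Icc 0 (C ^ 2))))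
    exact ⟨a, ha⟩
  have hnorm : ∀ J, Tendsto (fun n => ‖R J n‖ ^ 2) U
      (𝓝 (a - ∑ j ∈ Finset.range J, ‖Φ (j + 1)‖ ^ 2)) := by
    intro J
    induction J with
    | zero => simpa [hR0] using ha
    | succ J ih =>
      have := ih.sub (norm_sq_sub_of_weakLim hτ (hRw J))
      rw [Finset.sum_range_succ, ← sub_sub]
      refine this.congr fun n => ?_
      rw [hRs]; ring
  have hnn : ∀ J, 0 ≤ a - ∑ j ∈ Finset.range J, ‖Φ (j + 1)‖ ^ 2 := fun J =>
    ge_of_tendsto (hnorm J) (Eventually.of_forall fun n => by positivity)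
  -- Bessel's inequality: the squared norms of the profiles sum to at most `a`.
  have hΦ0 : Tendsto (fun j => ‖Φ (j + 1)‖) atTop (𝓝 0) := by
    have hs : Summable fun j => ‖Φ (j + 1)‖ ^ 2 :=
      summable_of_sum_range_le (c := a) (fun j => by positivity) fun J => by linarith [hnn J]
    have := (Real.continuous_sqrt.tendsto 0).comp hs.tendsto_atTop_zero
    simpa [Function.comp_def] using this
  -- The bound must not depend on `J`, so that one concentration constant serves all remainders. It
  -- follows from `2t ≤ t² + 1` and `0 ≤ a`.
  have hbd : ∀ J, ∀ᶠ n in (U : Filter ℕ), ‖R J n‖ ≤ a + 1 := by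
    intro J
    have hsum : 0 ≤ ∑ j ∈ Finset.range J, ‖Φ (j + 1)‖ ^ 2 :=
      Finset.sum_nonneg fun j _ => by positivity
    filter_upwards [(hnorm J).eventually_lt_const (u := a + 1) (by linarith)] with n hn
    nlinarith [sq_nonneg (‖R J n‖ - 1), norm_nonneg (R J n), hnn J]
  -- the functional `N`
  have he : ∀ J, ∃ e, Tendsto (fun n => N (R J n)) U (𝓝 e) := fun J =>
    ⟨_, (U.map fun n => N (R J n)).le_nhds_lim⟩
  choose e he using he
  -- Where `N` stays above `ε`, translates chosen by concentration have a weak limit `ψ` with `c ≤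
  -- ‖χ‖ ‖ψ‖`, and near-maximality gives `‖ψ‖ ≤ 2 ‖Φ (J + 1)‖`. The `+ 1` in `δ` guards against `χ =
  -- 0`.
  have hconc : ∀ ε : ℝ≥0∞, 0 < ε → ∃ δ > 0, ∀ J, ε < e J → δ ≤ ‖Φ (J + 1)‖ := by
    intro ε hε
    obtain ⟨χ, c, hc, hχ⟩ := hN (a + 1) ε hε
    refine ⟨c / (2 * (‖χ‖ + 1)), by positivity, fun J hJ => ?_⟩
    have hex : ∀ n, ∃ y, (‖R J n‖ ≤ a + 1 → ε ≤ N (R J n) → c ≤ ‖inner ℂ χ (τ y (R J n))‖) := by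
      intro n
      by_cases h1 : ‖R J n‖ ≤ a + 1 ∧ ε ≤ N (R J n)
      · obtain ⟨y, hy⟩ := hχ _ h1.1 h1.2
        exact ⟨y, fun _ _ => hy⟩
      · exact ⟨0, fun h2 h3 => absurd ⟨h2, h3⟩ h1⟩
    choose y hy using hex
    obtain ⟨CJ, hCJ⟩ := hRb J
    obtain ⟨ψ, hψ⟩ := exists_weakLim_of_bounded U (u := fun n => τ (y n) (R J n)) (C := CJ)
      (by simpa using hCJ)
    have h1 : c ≤ ‖inner ℂ χ ψ‖ := by
      refine ge_of_tendsto (hψ χ).norm ?_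
      filter_upwards [hbd J, (he J).eventually_const_lt hJ] with n h2 h3
      exact hy n h2 h3.le
    have h2 := h1.trans (norm_inner_le_norm _ _)
    have h3 := hRmax J y ψ hψ
    rw [div_le_iff₀ (by positivity)]
    nlinarith [norm_nonneg χ, norm_nonneg ψ, norm_nonneg (Φ (J + 1))]
  have he0 : ∀ J, Φ (J + 1) = 0 → e J = 0 := by
    intro J hJ
    by_contra hne
    obtain ⟨ε, h1, h2⟩ := exists_between (pos_iff_ne_zero.2 hne)
    obtain ⟨δ, hδ, h3⟩ := hconc ε h1
    have := h3 J h2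
    rw [hJ, norm_zero] at this
    linarith
  have het : Tendsto e atTop (𝓝 0) := by
    rw [ENNReal.tendsto_nhds_zero]
    intro ε hε
    obtain ⟨δ, hδ, h3⟩ := hconc ε hε
    filter_upwards [hΦ0.eventually_lt_const hδ] with J hJ
    by_contra hcon
    exact absurd (h3 J (not_le.1 hcon)) (not_le.2 hJ)
  -- extraction of the subsequence
  obtain ⟨D, hD⟩ := TopologicalSpace.exists_dense_seq H
  -- The limits the subsequence must retain: weak convergence tested on a dense sequence, the limit
  -- of `N`, and separation of centres when the later profile is nonzero.
  let F : ℕ → Filter ℕ := fun J =>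
    (⨅ i, comap (fun n => inner ℂ (D i) (τ (X (J + 1) n) (R (J + 1) n))) (𝓝 0)) ⊓
    (comap (fun n => N (R J n)) (𝓝 (e J)) ⊓
    ⨅ j, ⨅ _ : 1 ≤ j ∧ j < J ∧ Φ J ≠ 0, comap (fun n => ‖X j n - X J n‖) atTop)
  obtain ⟨σ, hσ, hF⟩ := exists_strictMono_tendsto_of_ultrafilter hU F (fun J => by
    refine le_inf (le_iInf fun i => ?_) (le_inf ?_ (le_iInf fun j => le_iInf fun hj => ?_))
    · rw [← tendsto_iff_comap]
      simpa using hzero J (D i)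
    · rw [← tendsto_iff_comap]
      exact he J
    · rw [← tendsto_iff_comap]
      exact horth j J hj.1 hj.2.1 hj.2.2)
  simp only [F, tendsto_inf, tendsto_iInf, tendsto_comap_iff] at hF
  have hls : ∀ J, limsup (fun n => N (R J (σ n))) atTop = e J := fun J =>
    (hF J).2.1.limsup_eq
  have hcommon : ∀ Jstar : ℕ∞, (∀ j : ℕ, 1 ≤ j → (j : ℕ∞) ≤ Jstar → Φ j ≠ 0) →
      (∀ j j' : ℕ, 1 ≤ j → (j : ℕ∞) ≤ Jstar → 1 ≤ j' → (j' : ℕ∞) ≤ Jstar → j ≠ j' →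
        Tendsto (fun n => ‖X j (σ n) - X j' (σ n)‖) atTop atTop) := by
    intro Jstar hne j j' h1 h2 h3 h4 h5
    rcases lt_or_gt_of_ne h5 with h6 | h6
    · exact (hF j').2.2 j ⟨h1, h6, hne j' h3 h4⟩
    · simp_rw [norm_sub_rev (X j _)]
      exact (hF j).2.2 j' ⟨h3, h6, hne j h1 h2⟩
  -- Extraction stops at the first `J` whose next profile is zero, where `e J = 0` already; if there
  -- is none, `Jstar` is infinite.
  have hmain : ∃ Jstar : ℕ∞, (∀ j : ℕ, 1 ≤ j → (j : ℕ∞) ≤ Jstar → Φ j ≠ 0) ∧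
      Tendsto e (toJstar Jstar) (𝓝 0) := by
    classical
    by_cases hfin : ∃ J, Φ (J + 1) = 0
    · refine ⟨(Nat.find hfin : ℕ), fun j h1 h2 h3 => ?_, ?_⟩
      · have h4 : j ≤ Nat.find hfin := by exact_mod_cast h2
        exact Nat.find_min hfin (m := j - 1) (by omega) (by rwa [Nat.sub_add_cancel h1])
      · rw [toJstar_coe, tendsto_pure_left]
        intro s hs
        rw [he0 _ (Nat.find_spec hfin)]
        exact mem_of_mem_nhds hs
    · push Not at hfin
      refine ⟨⊤, fun j h1 _ => ?_, het.mono_left toJstar_top⟩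
      have := hfin (j - 1)
      rwa [Nat.sub_add_cancel h1] at this
  obtain ⟨Jstar, hJ1, hJ2⟩ := hmain
  refine ⟨Jstar, Φ, fun j n => X j (σ n), σ, fun J n => R J (σ n), hσ, hJ1, fun n => congrFun hR0 _,
    fun J n => hRs J _, fun J => ?_, fun J => ?_, ?_, hcommon Jstar hJ1⟩
  · obtain ⟨C', hC'⟩ := hRb J
    exact ⟨C', fun n => hC' _⟩
  · obtain ⟨C', hC'⟩ := hRb (J + 1)
    exact weakLim_of_dense (C := C') (by simpa using fun n => hC' (σ n)) hD fun i => (hF J).1 i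
  · simp_rw [hls]
    exact hJ2

end Abstract

/-! ### Fourier transforms of tempered functions. -/

section Represents

variable {d : ℕ} {S T : 𝓢'(Rd d, ℂ)} {f g f' g' : Rd d → ℂ}

theorem Represents.congr (h : Represents T f) (he : f =ᵐ[volume] f') : Represents T f' := by
  intro ψ
  have h1 : (fun x => ψ x * f x) =ᵐ[volume] fun x => ψ x * f' x := by
    filter_upwards [he] with x hx
    rw [hx]
  exact ⟨(h ψ).1.congr h1, (h ψ).2.trans (integral_congr_ae h1)⟩

theorem Represents.add (hf : Represents T f) (hg : Represents S g) :
    Represents (T + S) (fun x => f x + g x) := by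
  intro ψ
  simp_rw [mul_add]
  refine ⟨(hf ψ).1.add (hg ψ).1, ?_⟩
  rw [integral_add (hf ψ).1 (hg ψ).1, ← (hf ψ).2, ← (hg ψ).2]
  rfl

theorem Represents.const_smul (c : ℂ) (hf : Represents T f) :
    Represents (c • T) (fun x => c * f x) := by
  intro ψ
  simp_rw [mul_left_comm _ c]
  refine ⟨(hf ψ).1.const_mul c, ?_⟩
  rw [integral_const_mul, ← (hf ψ).2]
  rfl

theorem Represents.ext (hT : Represents T f) (hS : Represents S f) : T = S := by
  ext ψ
  rw [(hT ψ).2, (hS ψ).2]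

theorem exists_schwartzMap_eq_ofReal {b : Rd d → ℝ} (hb : ContDiff ℝ (⊤ : ℕ∞) b)
    (hbs : HasCompactSupport b) : ∃ ψ : 𝓢(Rd d, ℂ), ∀ y, ψ y = (b y : ℂ) := by
  have hcs : HasCompactSupport (Complex.ofRealCLM ∘ b) := hbs.comp_left rfl
  have hcd : ContDiff ℝ (⊤ : ℕ∞) (Complex.ofRealCLM ∘ b) := by fun_prop
  exact ⟨hcs.toSchwartzMap hcd, fun y => by simp⟩

/-- Test against a smooth bump equal to one near the point. -/
theorem Represents.locallyIntegrable (hf : Represents T f) : LocallyIntegrable f := by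
  intro x
  obtain ⟨b⟩ : Nonempty (ContDiffBump x) := inferInstance
  obtain ⟨ψ, hψ⟩ := exists_schwartzMap_eq_ofReal b.contDiff b.hasCompactSupport
  refine ⟨Metric.closedBall x b.rIn, Metric.closedBall_mem_nhds x b.rIn_pos, ?_⟩
  refine ((hf ψ).1.integrableOn (s := Metric.closedBall x b.rIn)).congr_fun (fun y hy => ?_)
    measurableSet_closedBall
  simp [hψ, b.one_of_mem_closedBall hy]

theorem Represents.aestronglyMeasurable (hf : Represents T f) : AEStronglyMeasurable f :=
  hf.locallyIntegrable.aestronglyMeasurable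

theorem Represents.ae_eq (hf : Represents T f) (hg : Represents T g) : f =ᵐ[volume] g := by
  refine ae_eq_of_integral_contDiff_smul_eq hf.locallyIntegrable hg.locallyIntegrable ?_
  intro b hb hbs
  obtain ⟨ψ, hψ⟩ := exists_schwartzMap_eq_ofReal hb hbs
  simpa [hψ] using (hf ψ).2.symm.trans (hg ψ).2

theorem represents_toTemperedDistribution {p : ℝ≥0∞} [Fact (1 ≤ p)]
    (f : Lp (α := Rd d) ℂ p) : Represents (Lp.toTemperedDistribution f) f := by
  intro ψ
  have hpq := ENNReal.HolderConjugate.inv_one_sub_inv' (Fact.out : 1 ≤ p)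
  refine ⟨?_, by simp⟩
  exact MemLp.integrable_mul (p := (1 - p⁻¹)⁻¹) (q := p) (ψ.memLp _ _) (Lp.memLp f)

theorem IsFourierTransform.congr (h : IsFourierTransform f g) (hf : f =ᵐ[volume] f')
    (hg : g =ᵐ[volume] g') : IsFourierTransform f' g' := by
  obtain ⟨T, h1, h2⟩ := h
  exact ⟨T, h1.congr hf, h2.congr hg⟩

theorem IsFourierTransform.add (h : IsFourierTransform f g) (h' : IsFourierTransform f' g') :
    IsFourierTransform (fun x => f x + f' x) (fun x => g x + g' x) := by
  obtain ⟨T, h1, h2⟩ := h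
  obtain ⟨T', h1', h2'⟩ := h'
  exact ⟨T + T', h1.add h1', by rw [FourierTransform.fourier_add]; exact h2.add h2'⟩

theorem IsFourierTransform.const_smul (c : ℂ) (h : IsFourierTransform f g) :
    IsFourierTransform (fun x => c * f x) (fun x => c * g x) := by
  obtain ⟨T, h1, h2⟩ := h
  exact ⟨c • T, h1.const_smul c, by rw [FourierTransform.fourier_smul]; exact h2.const_smul c⟩

theorem IsFourierTransform.sub (h : IsFourierTransform f g) (h' : IsFourierTransform f' g') :
    IsFourierTransform (fun x => f x - f' x) (fun x => g x - g' x) := by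
  simpa [sub_eq_add_neg] using h.add (h'.const_smul (-1))

theorem IsFourierTransform.right_unique (h : IsFourierTransform f g)
    (h' : IsFourierTransform f g') : g =ᵐ[volume] g' := by
  obtain ⟨T, h1, h2⟩ := h
  obtain ⟨T', h1', h2'⟩ := h'
  obtain rfl := h1.ext h1'
  exact h2.ae_eq h2'

theorem IsFourierTransform.left_unique (h : IsFourierTransform f g)
    (h' : IsFourierTransform f' g) : f =ᵐ[volume] f' := by
  obtain ⟨T, h1, h2⟩ := h
  obtain ⟨T', h1', h2'⟩ := h'
  have h3 := h2.ext h2'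
  have h4 : T = T' := by
    have h5 := congrArg (fun A : 𝓢'(Rd d, ℂ) => (𝓕⁻ A : 𝓢'(Rd d, ℂ))) h3
    simpa only [FourierTransform.fourierInv_fourier_eq] using h5
  subst h4
  exact h1.ae_eq h1'

theorem IsFourierTransform.aestronglyMeasurable_left (h : IsFourierTransform f g) :
    AEStronglyMeasurable f := by
  obtain ⟨T, h1, h2⟩ := h
  exact h1.aestronglyMeasurable

theorem IsFourierTransform.aestronglyMeasurable_right (h : IsFourierTransform f g) :
    AEStronglyMeasurable g := by
  obtain ⟨T, h1, h2⟩ := h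
  exact h2.aestronglyMeasurable

theorem isFourierTransform_zero : IsFourierTransform (fun _ : Rd d => (0 : ℂ)) (fun _ => 0) := by
  refine ⟨0, fun ψ => by simp, fun ψ => ?_⟩
  simp

theorem fourierInv_comp_sub (u : Rd d → ℂ) (a ξ : Rd d) :
    𝓕⁻ (fun y => u (y - a)) ξ = (Real.fourierChar (inner ℝ a ξ) : ℂ) * 𝓕⁻ u ξ := by
  rw [Real.fourierInv_eq, Real.fourierInv_eq, ← integral_const_mul,
    ← integral_add_right_eq_self _ a]
  refine integral_congr_ae (Eventually.of_forall fun y => ?_)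
  simp only [add_sub_cancel_right, inner_add_left, AddChar.map_add_eq_mul, Circle.smul_def,
    Circle.coe_mul, smul_eq_mul]
  ring

theorem IsFourierTransform.translate (h : IsFourierTransform f g) (a : Rd d) :
    IsFourierTransform (fun x => f (x + a))
      (fun ξ => (Real.fourierChar (inner ℝ a ξ) : ℂ) * g ξ) := by
  obtain ⟨T, h1, h2⟩ := h
  refine ⟨PointwiseConvergenceCLM.precomp _ (SchwartzMap.compSubConstCLM ℂ a) T, fun ψ => ?_,
    fun ψ => ?_⟩
  · have h3 := h1 (SchwartzMap.compSubConstCLM ℂ a ψ)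
    simp only [SchwartzMap.compSubConstCLM_apply] at h3
    have h4 : ∀ x, ψ x * f (x + a) = (fun y => ψ (y - a) * f y) (x + a) := fun x => by simp
    simp_rw [h4]
    refine ⟨h3.1.comp_add_right a, ?_⟩
    rw [integral_add_right_eq_self (fun y => ψ (y - a) * f y)]
    exact h3.2
  -- `χ` is `ψ` times the character; as the inverse transform of a shifted transform it is visibly
  -- Schwartz.
  · let χ : 𝓢(Rd d, ℂ) := 𝓕⁻ (SchwartzMap.compSubConstCLM ℂ a (𝓕 ψ))
    have hχ : ∀ ξ, χ ξ = (Real.fourierChar (inner ℝ a ξ) : ℂ) * ψ ξ := by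
      intro ξ
      have h5 : χ ξ = 𝓕⁻ (fun y => (𝓕 ψ : 𝓢(Rd d, ℂ)) (y - a)) ξ := by
        simp only [χ, SchwartzMap.fourierInv_coe]
        rfl
      rw [h5, fourierInv_comp_sub]
      congr 1
      rw [← SchwartzMap.fourierInv_coe, FourierTransform.fourierInv_fourier_eq]
    have h3 := h2 χ
    simp_rw [hχ] at h3
    have h4 : ∀ ξ, ψ ξ * ((Real.fourierChar (inner ℝ a ξ) : ℂ) * g ξ) =
      (Real.fourierChar (inner ℝ a ξ) : ℂ) * ψ ξ * g ξ := fun ξ => by ring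
    simp_rw [h4]
    refine ⟨h3.1, ?_⟩
    rw [← h3.2, TemperedDistribution.fourier_apply, TemperedDistribution.fourier_apply]
    simp only [χ]
    rw [FourierTransform.fourier_fourierInv_eq]
    rfl

theorem isFourierTransform_of_memLp_two {g : Rd d → ℂ} (hg : MemLp g 2) :
    IsFourierTransform (𝓕⁻ hg.toLp : Lp (α := Rd d) ℂ 2) g := by
  refine ⟨Lp.toTemperedDistribution (𝓕⁻ hg.toLp), represents_toTemperedDistribution _, ?_⟩
  rw [Lp.fourier_toTemperedDistribution_eq, FourierTransform.fourier_fourierInv_eq]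
  exact (represents_toTemperedDistribution _).congr hg.coeFn_toLp

theorem exists_isFourierTransform_of_memLp_two {g : Rd d → ℂ} (hg : MemLp g 2) :
    ∃ f : Rd d → ℂ, IsFourierTransform f g ∧ MemLp f 2 ∧ eLpNorm f 2 volume = eLpNorm g 2 volume := by
  refine ⟨_, isFourierTransform_of_memLp_two hg, Lp.memLp _, ?_⟩
  have h1 : ‖(𝓕⁻ (hg.toLp g) : Lp (α := Rd d) ℂ 2 volume)‖ = ‖hg.toLp g‖ :=
    (Lp.fourierTransformₗᵢ (Rd d) ℂ).symm.norm_map _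
  rw [Lp.norm_def, Lp.norm_def, ENNReal.toReal_eq_toReal_iff' (Lp.eLpNorm_ne_top _)
    (Lp.eLpNorm_ne_top _), eLpNorm_congr_ae hg.coeFn_toLp] at h1
  exact h1

/-- The inverse transform is bounded, hence tempered. Fubini moves the transform onto the test
function, where Fourier inversion applies; the form `-innerₗ` encodes the inverse kernel. -/
theorem isFourierTransform_of_integrable {g : Rd d → ℂ} (hg : Integrable g) :
    IsFourierTransform (𝓕⁻ g) g := by
  have hcont : Continuous (𝓕⁻ g) := by
    rw [← Real.Lp.fourierTransformInv_toLp (memLp_one_iff_integrable.2 hg)]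
    exact BoundedContinuousFunction.continuous _
  have hb : ∀ x, ‖𝓕⁻ g x‖ ≤ ∫ ξ, ‖g ξ‖ := by
    intro x
    rw [Real.fourierInv_eq]
    refine (norm_integral_le_integral_norm _).trans (le_of_eq ?_)
    simp_rw [Circle.norm_smul]
  have hm : MemLp (𝓕⁻ g) ⊤ (volume : Measure (Rd d)) :=
    memLp_top_of_bound hcont.aestronglyMeasurable _ (Eventually.of_forall hb)
  have hR : Represents (Lp.toTemperedDistribution hm.toLp) (𝓕⁻ g) :=
    (represents_toTemperedDistribution _).congr hm.coeFn_toLp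
  refine ⟨_, hR, fun ψ => ⟨?_, ?_⟩⟩
  · refine hg.bdd_mul (c := (SchwartzMap.seminorm ℝ 0 0) ψ)
      ψ.continuous.aestronglyMeasurable (Eventually.of_forall fun x => ?_)
    exact SchwartzMap.norm_le_seminorm ℝ ψ x
  · rw [TemperedDistribution.fourier_apply, (hR _).2]
    have h1 := VectorFourier.integral_fourierIntegral_smul_eq_flip (f := (𝓕 ψ : 𝓢(Rd d, ℂ)))
      (g := g) (μ := volume) (ν := volume) (e := Real.fourierChar) (L := -innerₗ (Rd d))
      Real.continuous_fourierChar (by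
        simp only [LinearMap.neg_apply, innerₗ_apply_apply]
        fun_prop) (SchwartzMap.integrable _) hg
    have h2 : ∀ ξ, VectorFourier.fourierIntegral Real.fourierChar volume (-innerₗ (Rd d))
        (𝓕 ψ : 𝓢(Rd d, ℂ)) ξ = ψ ξ := by
      intro ξ
      have : VectorFourier.fourierIntegral Real.fourierChar volume (-innerₗ (Rd d))
        (𝓕 ψ : 𝓢(Rd d, ℂ)) ξ = (𝓕⁻ ((𝓕 ψ : 𝓢(Rd d, ℂ)) : Rd d → ℂ)) ξ := by
        rw [Real.fourierInv_eq, VectorFourier.fourierIntegral]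
        simp
      rw [this, ← SchwartzMap.fourierInv_coe, FourierTransform.fourierInv_fourier_eq]
    have h3 : ∀ x, VectorFourier.fourierIntegral Real.fourierChar volume (-innerₗ (Rd d)).flip
        g x = 𝓕⁻ g x := by
      intro x
      rw [Real.fourierInv_eq, VectorFourier.fourierIntegral]
      simp [real_inner_comm]
    simp_rw [h2, h3, smul_eq_mul] at h1
    exact h1.symm

end Represents

/-! ### Low and high frequencies. -/

section Sobolev

variable {d : ℕ}

/-- The symbol `2π|ξ|` of `|∇|`. -/
def freq (ξ : Rd d) : ℝ := 2 * Real.pi * ‖ξ‖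

theorem freq_nonneg (ξ : Rd d) : 0 ≤ freq ξ := by unfold freq; positivity

theorem continuous_freq : Continuous (freq : Rd d → ℝ) := by unfold freq; fun_prop

theorem measurable_freq : Measurable (freq : Rd d → ℝ) := continuous_freq.measurable

theorem ae_freq_pos (hd : 1 ≤ d) : ∀ᵐ ξ : Rd d, 0 < freq ξ := by
  have : Nonempty (Fin d) := ⟨⟨0, hd⟩⟩
  have h : ∀ᵐ ξ : Rd d, ξ ≠ 0 := by
    rw [ae_iff]; simp
  filter_upwards [h] with ξ hξ
  have := norm_pos_iff.2 hξ
  unfold freq; positivity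

theorem measurableSet_freq_le (N : ℝ) : MeasurableSet {ξ : Rd d | freq ξ ≤ N} :=
  measurableSet_le measurable_freq measurable_const

theorem weighted_apply (s : ℝ) (g : Rd d → ℂ) (ξ : Rd d) :
    weighted s g ξ = ((freq ξ ^ s : ℝ) : ℂ) * g ξ := rfl

theorem enorm_weighted (s : ℝ) (g : Rd d → ℂ) (ξ : Rd d) :
    ‖weighted s g ξ‖ₑ = ENNReal.ofReal (freq ξ ^ s) * ‖g ξ‖ₑ := by
  rw [weighted_apply, enorm_mul]
  congr 1
  rw [← ofReal_norm, Complex.norm_real, Real.norm_of_nonneg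
    (Real.rpow_nonneg (freq_nonneg ξ) s)]

theorem measurable_weighted {s : ℝ} {g : Rd d → ℂ} (hg : Measurable g) :
    Measurable (weighted s g) := by
  unfold weighted
  fun_prop

theorem weighted_congr {s : ℝ} {g g' : Rd d → ℂ} (h : g =ᵐ[volume] g') :
    weighted s g =ᵐ[volume] weighted s g' := by
  filter_upwards [h] with ξ hξ
  rw [weighted_apply, weighted_apply, hξ]

theorem eLpNorm_two_sq {α : Type*} [MeasurableSpace α] {μ : Measure α} (g : α → ℂ) :
    eLpNorm g 2 μ ^ 2 = ∫⁻ ξ, ‖g ξ‖ₑ ^ 2 ∂μ := by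
  rw [eLpNorm_eq_lintegral_rpow_enorm_toReal (by norm_num) (by norm_num)]
  simp only [ENNReal.toReal_ofNat, ENNReal.rpow_ofNat]
  rw [← ENNReal.rpow_natCast, ← ENNReal.rpow_mul]
  norm_num

/-- Polar coordinates: `2σ < d` gives integrability at the origin, and homogeneity gives the power
of `N`. -/
theorem exists_lintegral_freq_rpow_le (hd : 1 ≤ d) {σ : ℝ} (hσ : 2 * σ < d) :
    ∃ K : ℝ, 0 < K ∧ ∀ N : ℝ, 0 < N →
      ∫⁻ ξ in {ξ : Rd d | freq ξ ≤ N}, ENNReal.ofReal (freq ξ ^ (-2 * σ)) ≤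
        ENNReal.ofReal (K * N ^ ((d : ℝ) - 2 * σ)) := by
  have : Nonempty (Fin d) := ⟨⟨0, hd⟩⟩
  have hpi := Real.pi_pos
  set c := d * (volume : Measure (Rd d)).real (Metric.ball 0 1) with hc
  have hball : 0 < (volume : Measure (Rd d)).real (Metric.ball 0 1) :=
    ENNReal.toReal_pos (Metric.measure_ball_pos _ _ one_pos).ne' measure_ball_lt_top.ne
  have hdpos : (0 : ℝ) < d := by exact_mod_cast hd
  have hc0 : 0 < c := by positivity
  have hdσ : 0 < (d : ℝ) - 2 * σ := by linarith
  refine ⟨c * ((2 * Real.pi) ^ (-2 * σ) * ((2 * Real.pi)⁻¹ ^ ((d : ℝ) - 2 * σ) /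
    ((d : ℝ) - 2 * σ))), by positivity, fun N hN => ?_⟩
  set r := N / (2 * Real.pi) with hr
  have hr0 : 0 < r := by positivity
  let F : ℝ → ℝ := fun y => Set.indicator (Set.Iic r) (fun y => (2 * Real.pi * y) ^ (-2 * σ)) y
  have hset : ∀ ξ : Rd d, (freq ξ ≤ N ↔ ‖ξ‖ ≤ r) := by
    intro ξ
    rw [hr, le_div_iff₀ (by positivity), freq, mul_comm]
  have hpow : ∀ y ∈ Set.Ioi (0 : ℝ), y ^ (d - 1) • F y =
      Set.indicator (Set.Iic r) (fun y => (2 * Real.pi) ^ (-2 * σ) * y ^ ((d : ℝ) - 2 * σ - 1)) y := by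
    intro y hy
    have hy0 : (0 : ℝ) < y := hy
    simp only [F, Set.indicator_apply, smul_eq_mul]
    split_ifs with h
    · rw [Real.mul_rpow (by positivity) hy0.le, ← Real.rpow_natCast, Nat.cast_sub hd,
        mul_left_comm, ← Real.rpow_add hy0]
      congr 2
      push_cast; ring
    · simp
  have hint : IntegrableOn (fun y : ℝ => y ^ ((d : ℝ) - 2 * σ - 1)) (Set.Ioc 0 r) := by
    rw [← intervalIntegrable_iff_integrableOn_Ioc_of_le hr0.le]
    exact intervalIntegral.intervalIntegrable_rpow' (by linarith)
  have hFi : Integrable (fun ξ : Rd d => F ‖ξ‖) := by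
    rw [integrable_fun_norm_addHaar volume]
    rw [finrank_euclideanSpace_fin]
    rw [integrableOn_congr_fun hpow measurableSet_Ioi]
    rw [IntegrableOn, integrable_indicator_iff measurableSet_Iic, IntegrableOn,
      Measure.restrict_restrict measurableSet_Iic, Set.inter_comm, Set.Ioi_inter_Iic]
    exact hint.const_mul _
  have hval : ∫ ξ : Rd d, F ‖ξ‖ = c * ((2 * Real.pi) ^ (-2 * σ) * (r ^ ((d : ℝ) - 2 * σ) /
      ((d : ℝ) - 2 * σ))) := by
    rw [integral_fun_norm_addHaar volume, finrank_euclideanSpace_fin,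
      setIntegral_congr_fun measurableSet_Ioi hpow,
      setIntegral_indicator measurableSet_Iic, Set.Ioi_inter_Iic, integral_const_mul,
      ← intervalIntegral.integral_of_le hr0.le, integral_rpow (Or.inl (by linarith))]
    simp only [nsmul_eq_mul, smul_eq_mul, sub_add_cancel]
    rw [Real.zero_rpow hdσ.ne', sub_zero, hc]
    ring
  have hF0 : ∀ ξ : Rd d, 0 ≤ F ‖ξ‖ := fun ξ => Set.indicator_apply_nonneg fun _ => by
    positivity
  have h1 : ∫⁻ ξ in {ξ : Rd d | freq ξ ≤ N}, ENNReal.ofReal (freq ξ ^ (-2 * σ)) =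
      ENNReal.ofReal (∫ ξ : Rd d, F ‖ξ‖) := by
    rw [ofReal_integral_eq_lintegral_ofReal hFi (Eventually.of_forall hF0),
      ← lintegral_indicator (measurableSet_freq_le N)]
    refine lintegral_congr fun ξ => ?_
    by_cases h : freq ξ ≤ N
    · rw [Set.indicator_of_mem (show ξ ∈ {ξ : Rd d | freq ξ ≤ N} from h)]
      simp only [F]
      rw [Set.indicator_of_mem (show ‖ξ‖ ∈ Set.Iic r from (hset ξ).1 h)]
      rfl
    · rw [Set.indicator_of_notMem (show ξ ∉ {ξ : Rd d | freq ξ ≤ N} from h)]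
      simp only [F]
      rw [Set.indicator_of_notMem (show ‖ξ‖ ∉ Set.Iic r from fun h' => h ((hset ξ).2 h'))]
      simp
  rw [h1, hval]
  apply le_of_eq
  congr 1
  rw [hr, div_eq_mul_inv N, Real.mul_rpow hN.le (by positivity)]
  ring

/-- Low frequencies are integrable, by the Cauchy-Schwarz inequality. -/
theorem exists_lintegral_low_freq_le (hd : 1 ≤ d) {σ : ℝ} (hσ : 2 * σ < d) :
    ∃ C : ℝ, 0 < C ∧ ∀ (N : ℝ), 0 < N → ∀ g : Rd d → ℂ, Measurable g →
      ∫⁻ ξ in {ξ : Rd d | freq ξ ≤ N}, ‖g ξ‖ₑ ≤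
        ENNReal.ofReal (C * N ^ ((d : ℝ) / 2 - σ)) * eLpNorm (weighted σ g) 2 volume := by
  obtain ⟨K, hK, hKN⟩ := exists_lintegral_freq_rpow_le hd hσ
  refine ⟨K ^ (1 / 2 : ℝ), by positivity, fun N hN g hg => ?_⟩
  have hN' := hKN N hN
  have h1 : ∫⁻ ξ in {ξ : Rd d | freq ξ ≤ N}, ‖g ξ‖ₑ =
      ∫⁻ ξ in {ξ : Rd d | freq ξ ≤ N},
        ENNReal.ofReal (freq ξ ^ (-σ)) * ‖weighted σ g ξ‖ₑ := by
    refine lintegral_congr_ae (ae_restrict_of_ae ?_)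
    filter_upwards [ae_freq_pos hd] with ξ hξ
    rw [enorm_weighted, ← mul_assoc, ← ENNReal.ofReal_mul (by positivity), ← Real.rpow_add hξ]
    simp
  rw [h1]
  refine (ENNReal.lintegral_mul_le_Lp_mul_Lq _ Real.HolderConjugate.two_two
    (f := fun ξ : Rd d => ENNReal.ofReal (freq ξ ^ (-σ))) (g := fun ξ => ‖weighted σ g ξ‖ₑ)
    (by have := measurable_freq (d := d); fun_prop)
    ((measurable_weighted hg).enorm.aemeasurable)).trans ?_
  refine mul_le_mul' ?_ ?_
  · have h2 : ∀ ξ : Rd d, ENNReal.ofReal (freq ξ ^ (-σ)) ^ (2 : ℝ) =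
        ENNReal.ofReal (freq ξ ^ (-2 * σ)) := by
      intro ξ
      rw [ENNReal.ofReal_rpow_of_nonneg (Real.rpow_nonneg (freq_nonneg ξ) _) (by norm_num),
        ← Real.rpow_mul (freq_nonneg ξ)]
      congr 2; ring
    simp_rw [h2]
    refine (ENNReal.rpow_le_rpow hN' (by norm_num)).trans (le_of_eq ?_)
    rw [ENNReal.ofReal_rpow_of_nonneg (by positivity) (by norm_num),
      Real.mul_rpow hK.le (by positivity), ← Real.rpow_mul hN.le]
    congr 3; ring
  · have h3 : eLpNorm (weighted σ g) 2 volume =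
        (∫⁻ ξ, ‖weighted σ g ξ‖ₑ ^ (2 : ℝ)) ^ (1 / 2 : ℝ) := by
      rw [eLpNorm_eq_lintegral_rpow_enorm_toReal (by norm_num) (by norm_num)]
      simp
    rw [h3]
    exact ENNReal.rpow_le_rpow (setLIntegral_le_lintegral _ _) (by norm_num)

theorem integrable_low_freq (hd : 1 ≤ d) {σ : ℝ} (hσ : 2 * σ < d) {N : ℝ} (hN : 0 < N)
    {g : Rd d → ℂ} (hg : Measurable g) (hw : MemLp (weighted σ g) 2 volume) :
    Integrable ({ξ : Rd d | freq ξ ≤ N}.indicator g) := by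
  obtain ⟨C, hC, h⟩ := exists_lintegral_low_freq_le hd hσ
  rw [integrable_indicator_iff (measurableSet_freq_le N)]
  exact ⟨hg.aestronglyMeasurable, (h N hN g hg).trans_lt
    (ENNReal.mul_lt_top ENNReal.ofReal_lt_top hw.2)⟩

theorem memLp_high_freq {σ : ℝ} (hσ : 0 ≤ σ) {N : ℝ} (hN : 0 < N)
    {g : Rd d → ℂ} (hg : Measurable g) (hw : MemLp (weighted σ g) 2 volume) :
    MemLp ({ξ : Rd d | freq ξ ≤ N}ᶜ.indicator g) 2 := by
  refine hw.of_le_mul (c := (N ^ σ)⁻¹)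
    (hg.indicator (measurableSet_freq_le N).compl).aestronglyMeasurable
    (Eventually.of_forall fun ξ => ?_)
  have h0 : 0 < N ^ σ := by positivity
  by_cases h : freq ξ ≤ N
  · rw [Set.indicator_of_notMem (by simpa using h)]
    simp only [norm_zero]
    positivity
  · rw [Set.indicator_of_mem (by simpa using h), weighted_apply, norm_mul, Complex.norm_real,
      Real.norm_of_nonneg (Real.rpow_nonneg (freq_nonneg ξ) σ), ← mul_assoc]
    push Not at h
    have h1 : 1 ≤ (N ^ σ)⁻¹ * freq ξ ^ σ := by
      rw [inv_mul_eq_div, one_le_div h0]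
      exact Real.rpow_le_rpow hN.le h.le hσ
    nlinarith [norm_nonneg (g ξ)]

/-- Low frequencies are integrable and high ones square integrable, so each part is the transform of
a function. This realises every `L²` amplitude. -/
theorem exists_isFourierTransform (hd : 1 ≤ d) {σ : ℝ} (hσ0 : 0 ≤ σ) (hσ : 2 * σ < d)
    {g : Rd d → ℂ} (hg : AEStronglyMeasurable g) (hw : MemLp (weighted σ g) 2 volume) :
    ∃ f, IsFourierTransform f g := by
  let g' := hg.aemeasurable.mk g
  have hgg' : g =ᵐ[volume] g' := hg.aemeasurable.ae_eq_mk
  have hg' : Measurable g' := hg.aemeasurable.measurable_mk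
  have hw' : MemLp (weighted σ g') 2 volume := (memLp_congr_ae (weighted_congr hgg')).1 hw
  have h1 := isFourierTransform_of_integrable (integrable_low_freq hd hσ one_pos hg' hw')
  obtain ⟨f₂, h2, -, -⟩ := exists_isFourierTransform_of_memLp_two
    (memLp_high_freq hσ0 one_pos hg' hw')
  refine ⟨_, (h1.add h2).congr (ae_eq_refl _) ?_⟩
  filter_upwards [hgg'] with ξ hξ
  rw [hξ]
  exact Set.indicator_self_add_compl_apply _ g' ξ

theorem norm_fourierInv_le {g : Rd d → ℂ} {B : ℝ} (hB : 0 ≤ B)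
    (h : ∫⁻ ξ, ‖g ξ‖ₑ ≤ ENNReal.ofReal B) (x : Rd d) : ‖𝓕⁻ g x‖ ≤ B := by
  rw [Real.fourierInv_eq]
  refine (norm_integral_le_lintegral_norm _).trans ?_
  simp_rw [Circle.norm_smul, ofReal_norm]
  exact ENNReal.toReal_le_of_le_ofReal hB h

end Sobolev

/-! ### The Sobolev embedding. -/

section Sobolev

variable {d : ℕ}

theorem lintegral_Ioi_indicator_rpow_le {q L : ℝ} (hq : 2 < q) (hL : 0 ≤ L) :
    ∫⁻ l in Set.Ioi (0 : ℝ), (if l < L then ENNReal.ofReal (l ^ (q - 3)) else 0) ≤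
      ENNReal.ofReal (L ^ (q - 2) / (q - 2)) := by
  have h1 : ∀ l, (if l < L then ENNReal.ofReal (l ^ (q - 3)) else 0) =
      (Set.Iio L).indicator (fun l => ENNReal.ofReal (l ^ (q - 3))) l := fun l => rfl
  simp_rw [h1]
  rw [lintegral_indicator measurableSet_Iio, Measure.restrict_restrict measurableSet_Iio,
    Set.inter_comm, Set.Ioi_inter_Iio]
  have hint : IntegrableOn (fun y : ℝ => y ^ (q - 3)) (Set.Ioc 0 L) := by
    rw [← intervalIntegrable_iff_integrableOn_Ioc_of_le hL]
    exact intervalIntegral.intervalIntegrable_rpow' (by linarith)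
  refine (lintegral_mono_set Set.Ioo_subset_Ioc_self).trans (le_of_eq ?_)
  rw [← ofReal_integral_eq_lintegral_ofReal hint
    (ae_restrict_of_forall_mem measurableSet_Ioc fun y hy => Real.rpow_nonneg hy.1.le _),
    ← intervalIntegral.integral_of_le hL, integral_rpow (Or.inl (by linarith)),
    Real.zero_rpow (by linarith), sub_zero]
  congr 2 <;> ring_nf

/-- The distribution function of a function in `Ḣ^σ`, after splitting into low and high
frequencies at a height-dependent threshold. -/
theorem measure_lt_norm_le {l : ℝ} (hl : 0 < l) {S : Set (Rd d)} (hS : MeasurableSet S)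
    {f g : Rd d → ℂ} (h : IsFourierTransform f g) (hg : Measurable g)
    (hlow : ∫⁻ ξ in S, ‖g ξ‖ₑ ≤ ENNReal.ofReal (l / 2)) (hhigh : MemLp (Sᶜ.indicator g) 2) :
    volume {x | l < ‖f x‖} ≤ ENNReal.ofReal (4 / l ^ 2) * ∫⁻ ξ in Sᶜ, ‖g ξ‖ₑ ^ 2 := by
  have hint : Integrable (S.indicator g) := by
    rw [integrable_indicator_iff hS]
    exact ⟨hg.aestronglyMeasurable, hlow.trans_lt ENNReal.ofReal_lt_top⟩
  have h1 := isFourierTransform_of_integrable hint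
  obtain ⟨f₂, h2, hm, he⟩ := exists_isFourierTransform_of_memLp_two hhigh
  have hf : f =ᵐ[volume] fun x => 𝓕⁻ (S.indicator g) x + f₂ x := by
    refine h.left_unique ((h1.add h2).congr (ae_eq_refl _) (Eventually.of_forall fun ξ => ?_))
    exact Set.indicator_self_add_compl_apply _ g ξ
  have hsup : ∀ x, ‖𝓕⁻ (S.indicator g) x‖ ≤ l / 2 := by
    refine norm_fourierInv_le (by positivity) ?_
    simp_rw [enorm_indicator_eq_indicator_enorm]
    rwa [lintegral_indicator hS]
  have hsub : volume {x | l < ‖f x‖} ≤ volume {x | ENNReal.ofReal (l / 2) ≤ ‖f₂ x‖ₑ} := by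
    refine measure_mono_ae ?_
    filter_upwards [hf] with x hx hlx
    change l < ‖f x‖ at hlx
    change ENNReal.ofReal (l / 2) ≤ ‖f₂ x‖ₑ
    rw [← ofReal_norm]
    refine ENNReal.ofReal_le_ofReal ?_
    rw [hx] at hlx
    have := norm_add_le (𝓕⁻ (S.indicator g) x) (f₂ x)
    linarith [hsup x]
  refine hsub.trans ((meas_ge_le_mul_pow_eLpNorm_enorm volume (p := 2) (by norm_num) (by norm_num)
    hm.1 (by simpa using hl) (by simp)).trans (le_of_eq ?_))
  rw [he]
  simp only [ENNReal.toReal_ofNat, ENNReal.rpow_ofNat]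
  rw [eLpNorm_two_sq]
  congr 1
  · rw [← ENNReal.ofReal_inv_of_pos (by positivity), ← ENNReal.ofReal_pow (by positivity)]
    congr 1
    field_simp
    norm_num
  · rw [← lintegral_indicator hS.compl]
    refine lintegral_congr fun ξ => ?_
    by_cases hξ : ξ ∈ Sᶜ
    · simp only [Set.indicator_of_mem hξ]
    · simp only [Set.indicator_of_notMem hξ]
      simp

/-- Layer-cake formula with a frequency threshold depending on the height `l`. Low frequencies
contribute at most `l / 2` pointwise, so the level set is controlled by the `L²` mass of the high
ones; exchanging the integrals in `l` and `ξ` produces the weight of `Ḣ^σ`. -/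
theorem exists_lintegral_rpow_le (hd : 1 ≤ d) {σ q : ℝ} (hσ0 : 0 < σ) (hq : 2 < q)
    (hσ : σ = d / 2 - d / q) :
    ∃ C : ℝ≥0∞, C ≠ ⊤ ∧ ∀ f g : Rd d → ℂ, IsFourierTransform f g → Measurable g →
      eLpNorm (weighted σ g) 2 volume ≤ 1 → ∫⁻ x, ‖f x‖ₑ ^ q ≤ C := by
  have hdpos : (0 : ℝ) < d := by exact_mod_cast hd
  have hdq : 0 < d / q := by positivity
  obtain ⟨C, hC, hlow⟩ := exists_lintegral_low_freq_le hd (σ := σ) (by rw [hσ]; linarith)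
  refine ⟨ENNReal.ofReal q * (4 * ENNReal.ofReal ((2 * C) ^ (q - 2) / (q - 2))),
    ENNReal.mul_ne_top ENNReal.ofReal_ne_top (ENNReal.mul_ne_top (by norm_num)
      ENNReal.ofReal_ne_top), fun f g h hg hw => ?_⟩
  have hwm : MemLp (weighted σ g) 2 volume :=
    ⟨(measurable_weighted hg).aestronglyMeasurable, hw.trans_lt ENNReal.one_lt_top⟩
  -- the level set estimate
  let L : Rd d → ℝ := fun ξ => 2 * C * freq ξ ^ (d / q)
  have hLm : Measurable L := by
    have := measurable_freq (d := d)
    fun_prop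
  have hL0 : ∀ ξ, 0 ≤ L ξ := fun ξ => by
    have := freq_nonneg ξ
    positivity
  have hlevel : ∀ l, 0 < l → volume {x | l < ‖f x‖} ≤
      ENNReal.ofReal (4 / l ^ 2) * ∫⁻ ξ, (if l < L ξ then ‖g ξ‖ₑ ^ 2 else 0) := by
    intro l hl
    -- This threshold makes the low-frequency bound exactly `l / 2`; a frequency lies above it
    -- exactly when `l < L ξ`.
    set N := (l / (2 * C)) ^ (q / d) with hN
    have hN0 : 0 < N := by positivity
    have hset : ∀ ξ : Rd d, freq ξ ≤ N ↔ L ξ ≤ l := by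
      intro ξ
      rw [hN, ← inv_div (d : ℝ) q, Real.le_rpow_inv_iff_of_pos (freq_nonneg ξ) (by positivity) hdq,
        le_div_iff₀ (by positivity), mul_comm]
    have hNl : C * N ^ ((d : ℝ) / 2 - σ) = l / 2 := by
      have : (d : ℝ) / 2 - σ = d / q := by rw [hσ]; ring
      rw [this, hN, ← Real.rpow_mul (by positivity)]
      have : q / d * (d / q) = 1 := by field_simp
      rw [this, Real.rpow_one]
      field_simp
    have h1 := measure_lt_norm_le hl (measurableSet_freq_le N) h hg (by
      refine (hlow N hN0 g hg).trans ?_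
      rw [hNl]
      exact mul_le_of_le_one_right' hw) (memLp_high_freq hσ0.le hN0 hg hwm)
    refine h1.trans (le_of_eq ?_)
    congr 1
    rw [← lintegral_indicator (measurableSet_freq_le N).compl]
    refine lintegral_congr fun ξ => ?_
    simp only [Set.indicator_apply, Set.mem_compl_iff, Set.mem_ofPred_eq, hset, not_le]
  have hfm := h.aestronglyMeasurable_left
  have hlayer := lintegral_rpow_eq_lintegral_meas_lt_mul (volume : Measure (Rd d))
    (f := fun x => ‖f x‖) (Eventually.of_forall fun x => norm_nonneg _) hfm.norm.aemeasurable
    (p := q) (by linarith)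
  have h0 : ∀ x, ‖f x‖ₑ ^ q = ENNReal.ofReal (‖f x‖ ^ q) := by
    intro x
    rw [← ofReal_norm, ENNReal.ofReal_rpow_of_nonneg (norm_nonneg _) (by linarith)]
  simp_rw [h0]
  rw [hlayer]
  gcongr
  calc ∫⁻ l in Set.Ioi (0 : ℝ), volume {x | l < ‖f x‖} * ENNReal.ofReal (l ^ (q - 1))
      ≤ ∫⁻ l in Set.Ioi (0 : ℝ), ∫⁻ ξ : Rd d,
          4 * ((if l < L ξ then ENNReal.ofReal (l ^ (q - 3)) else 0) * ‖g ξ‖ₑ ^ 2) := by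
        refine setLIntegral_mono' measurableSet_Ioi fun l hl => ?_
        have hl0 : (0 : ℝ) < l := hl
        refine (mul_le_mul_left (hlevel l hl0) _).trans (le_of_eq ?_)
        rw [mul_right_comm, ← ENNReal.ofReal_mul (by positivity)]
        have h2 : 4 / l ^ 2 * l ^ (q - 1) = 4 * l ^ (q - 3) := by
          rw [show q - 1 = (q - 3) + 2 by ring, Real.rpow_add hl0]
          norm_num
          field_simp
        rw [h2, ENNReal.ofReal_mul (by norm_num), ENNReal.ofReal_ofNat, mul_assoc,
          lintegral_const_mul' _ _ (by norm_num),
          ← lintegral_const_mul' _ _ ENNReal.ofReal_ne_top]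
        congr 1
        refine lintegral_congr fun ξ => ?_
        split_ifs <;> simp
    _ = ∫⁻ ξ : Rd d, ∫⁻ l in Set.Ioi (0 : ℝ),
          4 * ((if l < L ξ then ENNReal.ofReal (l ^ (q - 3)) else 0) * ‖g ξ‖ₑ ^ 2) := by
        refine lintegral_lintegral_swap (Measurable.aemeasurable ?_)
        refine Measurable.const_mul (Measurable.mul (Measurable.ite ?_ ?_ measurable_const) ?_) _
        · exact measurableSet_lt measurable_fst (hLm.comp measurable_snd)
        · fun_prop
        · fun_prop
    _ ≤ ∫⁻ ξ : Rd d, 4 * ENNReal.ofReal ((2 * C) ^ (q - 2) / (q - 2)) *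
          ‖weighted σ g ξ‖ₑ ^ 2 := by
        refine lintegral_mono fun ξ => ?_
        rw [lintegral_const_mul' _ _ (by norm_num), mul_assoc,
          lintegral_mul_const' _ _ (by simp)]
        gcongr 4 * ?_
        refine (mul_le_mul_left (lintegral_Ioi_indicator_rpow_le hq (hL0 ξ)) _).trans (le_of_eq ?_)
        rw [enorm_weighted, mul_pow, ← mul_assoc, ← ENNReal.ofReal_pow (by
          have := freq_nonneg ξ; positivity), ← ENNReal.ofReal_mul (by
          have : 0 < q - 2 := by linarith
          positivity)]
        congr 2
        simp only [L]
        rw [Real.mul_rpow (by positivity) (Real.rpow_nonneg (freq_nonneg ξ) _),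
          ← Real.rpow_mul (freq_nonneg ξ), ← Real.rpow_natCast (freq ξ ^ σ) 2,
          ← Real.rpow_mul (freq_nonneg ξ)]
        -- The scaling relation turns the height exponent into the Sobolev weight.
        have : d / q * (q - 2) = σ * (2 : ℕ) := by
          rw [hσ]
          push_cast
          field_simp
        rw [this]
        ring
    _ ≤ _ := by
        rw [lintegral_const_mul' _ _ (ENNReal.mul_ne_top (by norm_num) ENNReal.ofReal_ne_top),
          ← eLpNorm_two_sq]
        exact mul_le_of_le_one_right' (pow_le_one' hw 2)

/-- The Sobolev embedding `Ḣ^σ ⊆ L^q`. -/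
theorem exists_eLpNorm_le_weighted (hd : 1 ≤ d) {σ q : ℝ} (hσ0 : 0 < σ) (hq : 2 < q)
    (hσ : σ = d / 2 - d / q) :
    ∃ C : ℝ≥0∞, C ≠ ⊤ ∧ ∀ f g : Rd d → ℂ, IsFourierTransform f g →
      MemLp (weighted σ g) 2 volume →
      eLpNorm f (ENNReal.ofReal q) volume ≤ C * eLpNorm (weighted σ g) 2 volume := by
  obtain ⟨C, hC, h⟩ := exists_lintegral_rpow_le hd hσ0 hq hσ
  refine ⟨C ^ (1 / q), ENNReal.rpow_ne_top_of_nonneg (by positivity) hC, fun f g hfg hw => ?_⟩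
  -- the estimate for every bound of the norm
  have hq0 : ENNReal.ofReal q ≠ 0 := by simpa using by linarith
  have key : ∀ A : ℝ, 0 < A → eLpNorm (weighted σ g) 2 volume ≤ ENNReal.ofReal A →
      eLpNorm f (ENNReal.ofReal q) volume ≤ C ^ (1 / q) * ENNReal.ofReal A := by
    intro A hA hle
    let c : ℂ := ((A⁻¹ : ℝ) : ℂ)
    have hc : ‖c‖ₑ = (ENNReal.ofReal A)⁻¹ := by
      rw [← ofReal_norm, Complex.norm_real, Real.norm_of_nonneg (by positivity),
        ENNReal.ofReal_inv_of_pos hA]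
    have hA0 : ENNReal.ofReal A ≠ 0 := by simpa using hA
    have hgm := hfg.aestronglyMeasurable_right.aemeasurable
    let g' := hgm.mk g
    have h1 := (hfg.congr (ae_eq_refl _) hgm.ae_eq_mk).const_smul c
    have h2 : weighted σ (fun ξ => c * g' ξ) =ᵐ[volume] c • weighted σ g := by
      filter_upwards [hgm.ae_eq_mk] with ξ hξ
      rw [Pi.smul_apply, weighted_apply, weighted_apply, smul_eq_mul, hξ]
      ring
    have h3 := h _ _ h1 (hgm.measurable_mk.const_mul c) (by
      rw [eLpNorm_congr_ae h2, eLpNorm_const_smul, hc, mul_comm, ← div_eq_mul_inv]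
      exact ENNReal.div_le_of_le_mul (by rwa [one_mul]))
    have h4 : eLpNorm (c • f) (ENNReal.ofReal q) volume ≤ C ^ (1 / q) := by
      rw [eLpNorm_eq_lintegral_rpow_enorm_toReal hq0 ENNReal.ofReal_ne_top,
        ENNReal.toReal_ofReal (by linarith)]
      exact ENNReal.rpow_le_rpow h3 (by positivity)
    rw [eLpNorm_const_smul, hc, mul_comm, ← div_eq_mul_inv] at h4
    rwa [ENNReal.div_le_iff hA0 ENNReal.ofReal_ne_top] at h4
  set A := eLpNorm (weighted σ g) 2 volume with hA
  have hAt : A ≠ ⊤ := hw.2.ne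
  -- `A` may vanish, so one normalises by `A.toReal + ε` and lets `ε` tend to zero.
  have hlim : Tendsto (fun ε : ℝ => C ^ (1 / q) * ENNReal.ofReal (A.toReal + ε)) (𝓝[>] 0)
      (𝓝 (C ^ (1 / q) * A)) := by
    refine ENNReal.Tendsto.const_mul ?_ (Or.inr (ENNReal.rpow_ne_top_of_nonneg (by positivity) hC))
    have : Tendsto (fun ε : ℝ => ENNReal.ofReal (A.toReal + ε)) (𝓝 0)
        (𝓝 (ENNReal.ofReal (A.toReal + 0))) :=
      (ENNReal.continuous_ofReal.comp (by fun_prop : Continuous fun ε : ℝ => A.toReal + ε)).tendsto 0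
    rw [add_zero, ENNReal.ofReal_toReal hAt] at this
    exact this.mono_left nhdsWithin_le_nhds
  refine ge_of_tendsto hlim ?_
  filter_upwards [self_mem_nhdsWithin] with ε hε
  have hε0 : (0 : ℝ) < ε := hε
  refine key _ (by positivity) ?_
  rw [← ENNReal.ofReal_toReal hAt]
  exact ENNReal.ofReal_le_ofReal (by simpa using hε0.le)

end Sobolev

/-! ### Multipliers and translations on `L²`. -/

section Multipliers

variable {d : ℕ}

/-- The Hilbert space `L²(ℝ^d)`. -/
abbrev L2 (d : ℕ) : Type := Lp (α := Rd d) ℂ 2 volume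

/-- A bounded symbol. -/
structure IsSymbol (m : Rd d → ℂ) : Prop where
  meas : Measurable m
  bound : ∀ ξ, ‖m ξ‖ ≤ 1

theorem IsSymbol.memLp {m : Rd d → ℂ} (hm : IsSymbol m) (h : L2 d) :
    MemLp (fun ξ => m ξ * h ξ) 2 volume := by
  refine (Lp.memLp h).mono (hm.meas.aestronglyMeasurable.mul (Lp.aestronglyMeasurable h))
    (Eventually.of_forall fun ξ => ?_)
  rw [norm_mul]
  exact mul_le_of_le_one_left (norm_nonneg _) (hm.bound ξ)

/-- Multiplication by a bounded symbol on `L²`. -/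
def mulSymbol {m : Rd d → ℂ} (hm : IsSymbol m) : L2 d →L[ℂ] L2 d :=
  LinearMap.mkContinuous
    { toFun := fun h => (hm.memLp h).toLp _
      map_add' := fun h k => by
        rw [← MemLp.toLp_add]
        refine MemLp.toLp_congr _ _ ?_
        filter_upwards [Lp.coeFn_add h k] with ξ hξ
        rw [hξ, Pi.add_apply, Pi.add_apply, mul_add]
      map_smul' := fun c h => by
        rw [RingHom.id_apply, ← MemLp.toLp_const_smul]
        refine MemLp.toLp_congr _ _ ?_
        filter_upwards [Lp.coeFn_smul c h] with ξ hξ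
        rw [hξ, Pi.smul_apply, Pi.smul_apply, smul_eq_mul, smul_eq_mul, mul_left_comm] }
    1 fun h => by
      rw [one_mul]
      refine Lp.norm_le_norm_of_ae_le ?_
      filter_upwards [(hm.memLp h).coeFn_toLp] with ξ hξ
      change ‖((hm.memLp h).toLp _ : L2 d) ξ‖ ≤ _
      rw [hξ, norm_mul]
      exact mul_le_of_le_one_left (norm_nonneg _) (hm.bound ξ)

theorem coeFn_mulSymbol {m : Rd d → ℂ} (hm : IsSymbol m) (h : L2 d) :
    (mulSymbol hm h : Rd d → ℂ) =ᵐ[volume] fun ξ => m ξ * h ξ :=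
  (hm.memLp h).coeFn_toLp

theorem norm_mulSymbol {m : Rd d → ℂ} (hm : IsSymbol m) (h : L2 d) :
    ‖mulSymbol hm h‖ = (eLpNorm (fun ξ => m ξ * h ξ) 2 volume).toReal := by
  rw [Lp.norm_def, eLpNorm_congr_ae (coeFn_mulSymbol hm h)]

theorem mulSymbol_comm {m m' : Rd d → ℂ} (hm : IsSymbol m) (hm' : IsSymbol m') (h : L2 d) :
    mulSymbol hm (mulSymbol hm' h) = mulSymbol hm' (mulSymbol hm h) := by
  refine Lp.ext ?_
  filter_upwards [coeFn_mulSymbol hm (mulSymbol hm' h), coeFn_mulSymbol hm' (mulSymbol hm h),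
    coeFn_mulSymbol hm h, coeFn_mulSymbol hm' h] with ξ h1 h2 h3 h4
  rw [h1, h2, h3, h4]
  ring

theorem isSymbol_char (a : Rd d) : IsSymbol fun ξ : Rd d => (Real.fourierChar (inner ℝ a ξ) : ℂ) := by
  refine ⟨Continuous.measurable ?_, fun ξ => (Circle.norm_coe _).le⟩
  have := Real.continuous_fourierChar
  fun_prop

/-- Translation by `a`, on the Fourier side. -/
def shift (a : Rd d) : L2 d →ₗᵢ[ℂ] L2 d where
  toLinearMap := (mulSymbol (isSymbol_char a)).toLinearMap
  norm_map' h := by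
    change ‖mulSymbol (isSymbol_char a) h‖ = ‖h‖
    rw [norm_mulSymbol, Lp.norm_def]
    congr 1
    refine eLpNorm_congr_norm_ae (Eventually.of_forall fun ξ => ?_)
    rw [norm_mul, Circle.norm_coe, one_mul]

theorem coeFn_shift (a : Rd d) (h : L2 d) :
    (shift a h : Rd d → ℂ) =ᵐ[volume] fun ξ => (Real.fourierChar (inner ℝ a ξ) : ℂ) * h ξ :=
  coeFn_mulSymbol (isSymbol_char a) h

theorem mulSymbol_shift {m : Rd d → ℂ} (hm : IsSymbol m) (a : Rd d) (h : L2 d) :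
    mulSymbol hm (shift a h) = shift a (mulSymbol hm h) :=
  mulSymbol_comm hm (isSymbol_char a) h

theorem integrable_conj_mul (k h : L2 d) :
    Integrable (fun ξ => (starRingEnd ℂ) (k ξ) * h ξ) volume :=
  (L2.integrable_inner (𝕜 := ℂ) k h).congr (Eventually.of_forall fun ξ => by
    simp [mul_comm])

/-- Matrix coefficients are inverse transforms of integrable functions. Their continuity, their
decay, and the recovery of a band-limited function from its amplitude rest on this. -/
theorem inner_shift (k h : L2 d) (a : Rd d) :
    inner ℂ k (shift a h) = 𝓕⁻ (fun ξ => (starRingEnd ℂ) (k ξ) * h ξ) a := by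
  rw [L2.inner_def, Real.fourierInv_eq]
  refine integral_congr_ae ?_
  filter_upwards [coeFn_shift a h] with ξ hξ
  rw [hξ, real_inner_comm a ξ]
  simp only [RCLike.inner_apply, Circle.smul_def, smul_eq_mul]
  ring

theorem continuous_fourierInv_of_integrable {g : Rd d → ℂ} (hg : Integrable g) :
    Continuous (𝓕⁻ g) := by
  rw [← Real.Lp.fourierTransformInv_toLp (memLp_one_iff_integrable.2 hg)]
  exact BoundedContinuousFunction.continuous _

theorem continuous_inner_shift (k h : L2 d) : Continuous fun a => inner ℂ k (shift a h) := by
  simp_rw [inner_shift]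
  exact continuous_fourierInv_of_integrable (integrable_conj_mul k h)

theorem isMixingAction_shift : IsMixingAction (shift : Rd d → L2 d →ₗᵢ[ℂ] L2 d) where
  zero h := by
    refine Lp.ext ?_
    filter_upwards [coeFn_shift 0 h] with ξ hξ
    rw [hξ]; simp
  add a b h := by
    refine Lp.ext ?_
    filter_upwards [coeFn_shift (a + b) h, coeFn_shift a (shift b h), coeFn_shift b h]
      with ξ h1 h2 h3
    rw [h1, h2, h3, inner_add_left, AddChar.map_add_eq_mul, Circle.coe_mul, mul_assoc]
  cont h := by
    rw [continuous_iff_continuousAt]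
    intro b
    rw [ContinuousAt, tendsto_iff_norm_sub_tendsto_zero]
    -- For isometries weak continuity implies strong: both norms are constant, so only the inner
    -- product varies.
    have h1 : Tendsto (fun a => ‖shift a h - shift b h‖ ^ 2) (𝓝 b) (𝓝 0) := by
      have h2 : ∀ a, ‖shift a h - shift b h‖ ^ 2 =
          2 * ‖h‖ ^ 2 - 2 * (inner ℂ (shift b h) (shift a h)).re := by
        intro a
        rw [norm_sub_sq (𝕜 := ℂ), LinearIsometry.norm_map, LinearIsometry.norm_map,
          ← inner_conj_symm]
        simp only [RCLike.conj_re, RCLike.re_to_complex]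
        ring
      simp_rw [h2]
      have h3 := (Complex.continuous_re.comp (continuous_inner_shift (shift b h) h)).tendsto b
      have h4 := (h3.const_mul 2).const_sub (2 * ‖h‖ ^ 2)
      have h5 : (inner ℂ (shift b h) (shift b h)).re = ‖h‖ ^ 2 := by
        rw [inner_self_eq_norm_sq_to_K, LinearIsometry.norm_map]
        simp only [Complex.coe_algebraMap, ← Complex.ofReal_pow, Complex.ofReal_re]
      simp only [Function.comp, h5, sub_self] at h4
      exact h4
    have h6 := (Real.continuous_sqrt.tendsto 0).comp h1
    simpa [Function.comp_def] using h6
  vanish k h := by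
    -- The form required by the Riemann–Lebesgue lemma, whose sign convention accounts for `-a`.
    have h1 : ∀ a : Rd d, inner ℂ k (shift a h) =
        ∫ v, Real.fourierChar (-inner ℝ v (-a)) • ((starRingEnd ℂ) (k v) * h v) := by
      intro a
      rw [inner_shift, Real.fourierInv_eq]
      simp
    simp_rw [h1]
    exact (tendsto_integral_exp_inner_smul_cocompact _).comp
      (Homeomorph.neg (Rd d)).isClosedEmbedding.tendsto_cocompact

end Multipliers

/-! ### Amplitudes: `Ḣ^1 ∩ Ḣ^s` as a copy of `L²`. -/

section Amplitude

variable {d : ℕ}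

/-- The weight `2π|ξ| + (2π|ξ|)^s`. -/
def totalWeight (s : ℝ) (ξ : Rd d) : ℝ := freq ξ + freq ξ ^ s

theorem totalWeight_nonneg (s : ℝ) (ξ : Rd d) : 0 ≤ totalWeight s ξ :=
  add_nonneg (freq_nonneg ξ) (Real.rpow_nonneg (freq_nonneg ξ) s)

theorem totalWeight_pos (s : ℝ) {ξ : Rd d} (h : 0 < freq ξ) : 0 < totalWeight s ξ := by
  unfold totalWeight
  have := Real.rpow_nonneg h.le s
  positivity

theorem measurable_totalWeight (s : ℝ) : Measurable (totalWeight s : Rd d → ℝ) := by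
  unfold totalWeight
  have := measurable_freq (d := d)
  fun_prop

/-- The function on the Fourier side with amplitude `h`. -/
def deweight (s : ℝ) (h : Rd d → ℂ) (ξ : Rd d) : ℂ := (((totalWeight s ξ)⁻¹ : ℝ) : ℂ) * h ξ

/-- The Fourier transform of `f` is `h / (2π|ξ| + (2π|ξ|)^s)`. -/
def HasAmp (s : ℝ) (f : Rd d → ℂ) (h : L2 d) : Prop := IsFourierTransform f (deweight s h)

/-- The symbol `(2π|ξ|)^σ / (2π|ξ| + (2π|ξ|)^s)`. -/
def relSymbol (σ s : ℝ) (ξ : Rd d) : ℂ := ((freq ξ ^ σ * (totalWeight s ξ)⁻¹ : ℝ) : ℂ)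

theorem weighted_deweight (σ s : ℝ) (h : Rd d → ℂ) :
    weighted σ (deweight s h) = fun ξ => relSymbol σ s ξ * h ξ := by
  ext ξ
  rw [weighted_apply, deweight, relSymbol]
  push_cast
  ring

theorem norm_relSymbol (σ s : ℝ) (ξ : Rd d) :
    ‖relSymbol σ s ξ‖ = freq ξ ^ σ * (totalWeight s ξ)⁻¹ := by
  rw [relSymbol, Complex.norm_real, Real.norm_of_nonneg]
  exact mul_nonneg (Real.rpow_nonneg (freq_nonneg ξ) _) (inv_nonneg.2 (totalWeight_nonneg s ξ))

/-- Compare with `t` when `t ≥ 1` and with `t ^ s` when `t ≤ 1`. It bounds the symbols of both norms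
and of the intermediate `Ḣ^σ`. -/
theorem rpow_le_add_rpow {t s σ : ℝ} (ht : 0 ≤ t) (hs : 0 ≤ s) (h1 : s ≤ σ) (h2 : σ ≤ 1) :
    t ^ σ ≤ t + t ^ s := by
  have h0 := Real.rpow_nonneg ht s
  rcases le_total 1 t with h | h
  · have := Real.rpow_le_rpow_of_exponent_le h h2
    rw [Real.rpow_one] at this
    linarith
  · have := Real.rpow_le_rpow_of_exponent_ge' ht h hs h1
    linarith

theorem isSymbol_relSymbol {σ s : ℝ} (hs : 0 ≤ s) (h1 : s ≤ σ) (h2 : σ ≤ 1) :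
    IsSymbol (relSymbol σ s : Rd d → ℂ) := by
  refine ⟨?_, fun ξ => ?_⟩
  · unfold relSymbol
    have := measurable_freq (d := d)
    have := measurable_totalWeight (d := d) s
    fun_prop
  · rw [norm_relSymbol]
    refine (mul_le_mul_of_nonneg_right (rpow_le_add_rpow (freq_nonneg ξ) hs h1 h2)
      (inv_nonneg.2 (totalWeight_nonneg s ξ))).trans ?_
    exact mul_inv_le_one

theorem HasAmp.congr {s : ℝ} {f f' : Rd d → ℂ} {h : L2 d} (hf : HasAmp s f h)
    (e : f =ᵐ[volume] f') : HasAmp s f' h :=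
  IsFourierTransform.congr hf e (ae_eq_refl _)

theorem HasAmp.add {s : ℝ} {f f' : Rd d → ℂ} {h h' : L2 d} (hf : HasAmp s f h)
    (hf' : HasAmp s f' h') : HasAmp s (fun x => f x + f' x) (h + h') := by
  refine (IsFourierTransform.add hf hf').congr (ae_eq_refl _) ?_
  filter_upwards [Lp.coeFn_add h h'] with ξ hξ
  simp only [deweight, hξ, Pi.add_apply]
  ring

theorem HasAmp.sub {s : ℝ} {f f' : Rd d → ℂ} {h h' : L2 d} (hf : HasAmp s f h)
    (hf' : HasAmp s f' h') : HasAmp s (fun x => f x - f' x) (h - h') := by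
  refine (IsFourierTransform.sub hf hf').congr (ae_eq_refl _) ?_
  filter_upwards [Lp.coeFn_sub h h'] with ξ hξ
  simp only [deweight, hξ, Pi.sub_apply]
  ring

theorem HasAmp.const_smul {s : ℝ} {f : Rd d → ℂ} {h : L2 d} (c : ℂ) (hf : HasAmp s f h) :
    HasAmp s (fun x => c * f x) (c • h) := by
  refine (IsFourierTransform.const_smul c hf).congr (ae_eq_refl _) ?_
  filter_upwards [Lp.coeFn_smul c h] with ξ hξ
  simp only [deweight, hξ, Pi.smul_apply, smul_eq_mul]
  ring

theorem hasAmp_zero (s : ℝ) : HasAmp s (fun _ : Rd d => (0 : ℂ)) 0 := by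
  refine isFourierTransform_zero.congr (ae_eq_refl _) ?_
  filter_upwards [Lp.coeFn_zero ℂ 2 (volume : Measure (Rd d))] with ξ hξ
  simp only [deweight, hξ, Pi.zero_apply, mul_zero]

theorem HasAmp.translate {s : ℝ} {f : Rd d → ℂ} {h : L2 d} (hf : HasAmp s f h) (a : Rd d) :
    HasAmp s (fun x => f (x + a)) (shift a h) := by
  refine (IsFourierTransform.translate hf a).congr (ae_eq_refl _) ?_
  filter_upwards [coeFn_shift a h] with ξ hξ
  simp only [deweight, hξ]
  ring

theorem HasAmp.ae_eq {s : ℝ} {f f' : Rd d → ℂ} {h : L2 d} (hf : HasAmp s f h)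
    (hf' : HasAmp s f' h) : f =ᵐ[volume] f' :=
  IsFourierTransform.left_unique hf hf'

theorem HasAmp.eq_zero_of_ae_eq_zero (hd : 1 ≤ d) {s : ℝ} {f : Rd d → ℂ} {h : L2 d}
    (hf : HasAmp s f h) (e : f =ᵐ[volume] 0) : h = 0 := by
  have h1 := (hf.congr e).right_unique isFourierTransform_zero
  rw [Lp.eq_zero_iff_ae_eq_zero]
  filter_upwards [h1, ae_freq_pos hd] with ξ h2 h3
  have h4 := (totalWeight_pos s h3).ne'
  simpa [deweight, h4] using h2

theorem fourierFn_ae_eq {f g : Rd d → ℂ} (h : IsFourierTransform f g) :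
    fourierFn f =ᵐ[volume] g := by
  have hex : ∃ g, IsFourierTransform f g := ⟨g, h⟩
  rw [fourierFn, dif_pos hex]
  exact hex.choose_spec.right_unique h

theorem hdotNorm_eq {f g : Rd d → ℂ} (h : IsFourierTransform f g) (s : ℝ) :
    hdotNorm s f = (eLpNorm (weighted s g) 2 volume).toReal := by
  rw [hdotNorm, eLpNorm_congr_ae (weighted_congr (fourierFn_ae_eq h))]

theorem HasAmp.hdotNorm_eq {s σ : ℝ} {f : Rd d → ℂ} {h : L2 d} (hf : HasAmp s f h)
    (hm : IsSymbol (relSymbol σ s : Rd d → ℂ)) : hdotNorm σ f = ‖mulSymbol hm h‖ := by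
  rw [Bubble.hdotNorm_eq hf, norm_mulSymbol, weighted_deweight]

theorem HasAmp.memHdot {s σ : ℝ} {f : Rd d → ℂ} {h : L2 d} (hf : HasAmp s f h)
    (hm : IsSymbol (relSymbol σ s : Rd d → ℂ)) : MemHdot σ f :=
  ⟨_, hf, by rw [weighted_deweight]; exact hm.memLp h⟩

theorem HasAmp.memX {s : ℝ} (hs : 0 ≤ s) (hs1 : s ≤ 1) {f : Rd d → ℂ} {h : L2 d}
    (hf : HasAmp s f h) : MemX s f :=
  ⟨hf.memHdot (isSymbol_relSymbol hs hs1 le_rfl), hf.memHdot (isSymbol_relSymbol hs le_rfl hs1)⟩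

/-- The amplitude is the sum of the two weighted transforms, so the triangle inequality bounds it.
-/
theorem MemX.exists_hasAmp (hd : 1 ≤ d) {s : ℝ} {f : Rd d → ℂ} (hf : MemX s f) :
    ∃ h : L2 d, HasAmp s f h ∧ ‖h‖ ≤ hdotNorm 1 f + hdotNorm s f := by
  obtain ⟨⟨g, hg, hg1⟩, ⟨g', hg', hgs⟩⟩ := hf
  have hgs : MemLp (weighted s g) 2 volume :=
    (memLp_congr_ae (weighted_congr (hg'.right_unique hg))).1 hgs
  have hsum := hg1.add hgs
  refine ⟨hsum.toLp _, hg.congr (ae_eq_refl _) ?_, ?_⟩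
  · filter_upwards [hsum.coeFn_toLp, ae_freq_pos hd] with ξ h1 h2
    rw [deweight, h1, Pi.add_apply, weighted_apply, weighted_apply, ← add_mul, Real.rpow_one,
      ← Complex.ofReal_add, ← mul_assoc, ← Complex.ofReal_mul]
    have h3 : (totalWeight s ξ)⁻¹ * (freq ξ + freq ξ ^ s) = 1 :=
      inv_mul_cancel₀ (totalWeight_pos s h2).ne'
    rw [h3, Complex.ofReal_one, one_mul]
  · rw [Lp.norm_toLp, hdotNorm_eq hg, hdotNorm_eq hg,
      ← ENNReal.toReal_add hg1.2.ne hgs.2.ne]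
    exact ENNReal.toReal_mono (ENNReal.add_ne_top.2 ⟨hg1.2.ne, hgs.2.ne⟩)
      (eLpNorm_add_le hg1.1 hgs.1 (by norm_num))

end Amplitude

/-- The exponents of a subcritical embedding `Ḣ^1 ∩ Ḣ^s ⊆ Ḣ^σ ⊆ L^q`. -/
structure Admissible (d : ℕ) (s σ q : ℝ) : Prop where
  one_le_dim : 1 ≤ d
  s_nonneg : 0 ≤ s
  s_lt : s < σ
  lt_one : σ < 1
  two_lt : 2 < q
  scaling : σ = d / 2 - d / q

/-! ### Concentration and local compactness in `L^q`. -/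

section

variable {d : ℕ} {s σ q : ℝ}

theorem Admissible.pos (A : Admissible d s σ q) : 0 < σ := A.s_nonneg.trans_lt A.s_lt

theorem Admissible.two_mul_lt (A : Admissible d s σ q) : 2 * σ < d := by
  have h1 : (0 : ℝ) < d := by exact_mod_cast A.one_le_dim
  have h2 := A.two_lt
  have h3 : 0 < d / q := by positivity
  have := A.scaling
  linarith

theorem Admissible.isSymbol (A : Admissible d s σ q) :
    IsSymbol (relSymbol σ s : Rd d → ℂ) := isSymbol_relSymbol A.s_nonneg A.s_lt.le A.lt_one.le

theorem Admissible.fact (A : Admissible d s σ q) : Fact (1 ≤ ENNReal.ofReal q) :=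
  ⟨by rw [ENNReal.one_le_ofReal]; linarith [A.two_lt]⟩

theorem Admissible.one_le (A : Admissible d s σ q) : 1 ≤ ENNReal.ofReal q := A.fact.out

theorem Admissible.exists_hasAmp (A : Admissible d s σ q) (h : L2 d) :
    ∃ f : Rd d → ℂ, HasAmp s f h := by
  refine exists_isFourierTransform A.one_le_dim A.pos.le A.two_mul_lt ?_ ?_
  · refine AEStronglyMeasurable.mul (Measurable.aestronglyMeasurable ?_) (Lp.aestronglyMeasurable h)
    have := measurable_totalWeight (d := d) s
    fun_prop
  · rw [weighted_deweight]
    exact A.isSymbol.memLp h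

theorem Admissible.exists_eLpNorm_le (A : Admissible d s σ q) :
    ∃ C : ℝ, 0 ≤ C ∧ ∀ (f : Rd d → ℂ) (h : L2 d), HasAmp s f h →
      eLpNorm f (ENNReal.ofReal q) volume ≤ ENNReal.ofReal (C * ‖mulSymbol A.isSymbol h‖) := by
  obtain ⟨C, hC, hle⟩ := exists_eLpNorm_le_weighted A.one_le_dim A.pos A.two_lt A.scaling
  refine ⟨C.toReal, ENNReal.toReal_nonneg, fun f h hf => ?_⟩
  have hm : MemLp (weighted σ (deweight s h)) 2 (volume : Measure (Rd d)) := by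
    rw [weighted_deweight]
    exact A.isSymbol.memLp h
  refine (hle f _ hf hm).trans (le_of_eq ?_)
  rw [ENNReal.ofReal_mul ENNReal.toReal_nonneg, ENNReal.ofReal_toReal hC, norm_mulSymbol,
    ENNReal.ofReal_toReal (A.isSymbol.memLp h).2.ne, weighted_deweight]

theorem norm_mulSymbol_le {m : Rd d → ℂ} (hm : IsSymbol m) (h : L2 d) :
    ‖mulSymbol hm h‖ ≤ ‖h‖ := by
  refine Lp.norm_le_norm_of_ae_le ?_
  filter_upwards [coeFn_mulSymbol hm h] with ξ hξ
  rw [hξ, norm_mul]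
  exact mul_le_of_le_one_left (norm_nonneg _) (hm.bound ξ)

theorem Admissible.memLp (A : Admissible d s σ q) {f : Rd d → ℂ} {h : L2 d}
    (hf : HasAmp s f h) : MemLp f (ENNReal.ofReal q) volume := by
  obtain ⟨C, -, hle⟩ := A.exists_eLpNorm_le
  exact ⟨IsFourierTransform.aestronglyMeasurable_left hf,
    (hle f h hf).trans_lt ENNReal.ofReal_lt_top⟩

/-- Subcriticality: the quotient is at most `t ^ (σ - s)`, small near zero, and at most `t ^ (σ -
1)`, small near infinity. -/
theorem Admissible.exists_freq_tail (A : Admissible d s σ q) {ε : ℝ} (hε : 0 < ε) :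
    ∃ R : ℝ, 0 < R ∧ ∀ t : ℝ, 0 < t → ¬ (R⁻¹ ≤ t ∧ t ≤ R) → t ^ σ * (t + t ^ s)⁻¹ ≤ ε := by
  have h1 := tendsto_rpow_neg_atTop (y := 1 - σ) (by linarith [A.lt_one])
  have h2 := tendsto_rpow_neg_atTop (y := σ - s) (by linarith [A.s_lt])
  obtain ⟨R, h3, h4, h5⟩ := ((h1.eventually_le_const hε).and
    ((h2.eventually_le_const hε).and (eventually_gt_atTop 0))).exists
  refine ⟨R, h5, fun t ht hn => ?_⟩
  have hs := Real.rpow_pos_of_pos ht s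
  rw [← div_eq_mul_inv, div_le_iff₀ (by positivity)]
  by_cases hR : t ≤ R
  · have h6 : t < R⁻¹ := by
      by_contra hcon
      exact hn ⟨not_lt.1 hcon, hR⟩
    have h7 : t ^ (σ - s) ≤ ε := by
      refine (Real.rpow_le_rpow ht.le h6.le (by linarith [A.s_lt])).trans ?_
      rwa [Real.inv_rpow h5.le, ← Real.rpow_neg h5.le]
    have h8 : t ^ σ = t ^ (σ - s) * t ^ s := by rw [← Real.rpow_add ht]; congr 1; ring
    rw [h8]
    nlinarith
  · push Not at hR
    have h7 : t ^ (-(1 - σ)) ≤ ε :=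
      (Real.rpow_le_rpow_of_nonpos h5 hR.le (by linarith [A.lt_one])).trans h3
    have h8 : t ^ σ = t ^ (-(1 - σ)) * t := by
      conv_rhs => rw [← Real.rpow_one t, ← Real.rpow_mul ht.le, ← Real.rpow_add ht]
      congr 1; ring
    rw [h8]
    nlinarith

/-- Up to a small error in `L^q`, a function in `Ḣ^1 ∩ Ḣ^s` has a bounded frequency band, and is
given there by testing its translates against a fixed vector. -/
theorem Admissible.exists_band_approx (A : Admissible d s σ q) {ε : ℝ} (hε : 0 < ε) :
    ∃ (χ : L2 d) (K : ℝ), 0 ≤ K ∧ ∀ (f : Rd d → ℂ) (h : L2 d), HasAmp s f h →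
      eLpNorm (fun x => f x - inner ℂ χ (shift x h)) (ENNReal.ofReal q) volume ≤
        ENNReal.ofReal (ε * ‖h‖) ∧
      eLpNorm (fun x => inner ℂ χ (shift x h)) 2 volume ≤ ENNReal.ofReal (K * ‖h‖) := by
  obtain ⟨C, hC, hle⟩ := A.exists_eLpNorm_le
  obtain ⟨R, hR, htail⟩ := A.exists_freq_tail (ε := ε / (C + 1)) (by positivity)
  -- Off this band the relative symbol is at most `ε / (C + 1)`, and `C` is the embedding constant.
  let B : Set (Rd d) := {ξ | R⁻¹ ≤ freq ξ ∧ freq ξ ≤ R}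
  have hB : MeasurableSet B :=
    (measurableSet_le measurable_const measurable_freq).inter
      (measurableSet_le measurable_freq measurable_const)
  have hBfin : volume B ≠ ⊤ := by
    refine ne_top_of_le_ne_top (measure_closedBall_lt_top (μ := volume) (x := (0 : Rd d))
      (r := R / (2 * Real.pi))).ne (measure_mono fun ξ hξ => ?_)
    have := hξ.2
    have hpi := Real.pi_pos
    rw [mem_closedBall_zero_iff, le_div_iff₀ (by positivity), mul_comm]
    exact this
  have hband : IsSymbol (B.indicator fun _ => (1 : ℂ)) := by
    refine ⟨measurable_const.indicator hB, fun ξ => ?_⟩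
    by_cases h : ξ ∈ B <;> simp [h]
  -- Paired with `h`, this truncated inverse weight reproduces the transform of `f` on `B`. It is at
  -- most `R`, since the total weight there is at least `R⁻¹`, and so lies in `L²`.
  let c : Rd d → ℂ := B.indicator fun ξ => (((totalWeight s ξ)⁻¹ : ℝ) : ℂ)
  have hcb : ∀ ξ, ‖c ξ‖ ≤ R := by
    intro ξ
    by_cases h : ξ ∈ B
    · simp only [c, Set.indicator_of_mem h]
      have h1 : R⁻¹ ≤ totalWeight s ξ :=
        h.1.trans (le_add_of_nonneg_right (Real.rpow_nonneg (freq_nonneg ξ) s))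
      rw [Complex.norm_real, Real.norm_of_nonneg (inv_nonneg.2 (totalWeight_nonneg s ξ))]
      exact inv_le_of_inv_le₀ hR h1
    · simp only [c, Set.indicator_of_notMem h, norm_zero]
      exact hR.le
  have hcm : Measurable c := by
    refine Measurable.indicator ?_ hB
    have := measurable_totalWeight (d := d) s
    fun_prop
  have hc2 : MemLp c 2 volume := by
    have h1 : c = B.indicator c := by
      simp only [c, Set.indicator_indicator, Set.inter_self]
    rw [h1, memLp_indicator_iff_restrict hB]
    have : IsFiniteMeasure (volume.restrict B) := ⟨by
      rw [Measure.restrict_apply_univ]; exact hBfin.lt_top⟩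
    exact MemLp.of_bound hcm.aestronglyMeasurable R (Eventually.of_forall hcb)
  have hcstar : ∀ ξ, (starRingEnd ℂ) (c ξ) = c ξ := by
    intro ξ
    by_cases h : ξ ∈ B
    · simp only [c, Set.indicator_of_mem h, Complex.conj_ofReal]
    · simp only [c, Set.indicator_of_notMem h, map_zero]
  refine ⟨hc2.toLp c, R, hR.le, fun f h hf => ?_⟩
  set χ : L2 d := hc2.toLp c with hχ
  let g : Rd d → ℂ := fun ξ => (starRingEnd ℂ) (χ ξ) * h ξ
  have hfm : IsFourierTransform (fun x => inner ℂ χ (shift x h)) g := by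
    simp_rw [inner_shift]
    exact isFourierTransform_of_integrable (integrable_conj_mul χ h)
  have hgae : g =ᵐ[volume] fun ξ => c ξ * h ξ := by
    filter_upwards [hc2.coeFn_toLp] with ξ hξ
    simp only [g, hχ, hξ, hcstar]
  have hamp : HasAmp s (fun x => inner ℂ χ (shift x h)) (mulSymbol hband h) := by
    refine hfm.congr (ae_eq_refl _) ?_
    filter_upwards [hgae, coeFn_mulSymbol hband h] with ξ h1 h2
    rw [h1, deweight, h2]
    by_cases h : ξ ∈ B
    · simp only [c, Set.indicator_of_mem h, one_mul]
    · simp only [c, Set.indicator_of_notMem h, zero_mul, mul_zero]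
  refine ⟨(hle _ _ (HasAmp.sub hf hamp)).trans (ENNReal.ofReal_le_ofReal ?_), ?_⟩
  · have h1 : ‖mulSymbol A.isSymbol (h - mulSymbol hband h)‖ ≤ ε / (C + 1) * ‖h‖ := by
      refine Lp.norm_le_mul_norm_of_ae_le_mul ?_
      filter_upwards [coeFn_mulSymbol A.isSymbol (h - mulSymbol hband h),
        Lp.coeFn_sub h (mulSymbol hband h), coeFn_mulSymbol hband h,
        ae_freq_pos A.one_le_dim] with ξ h1 h2 h3 h4
      rw [h1, h2, Pi.sub_apply, h3]
      by_cases hξ : ξ ∈ B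
      · rw [Set.indicator_of_mem hξ, one_mul, sub_self, mul_zero, norm_zero]
        positivity
      · rw [Set.indicator_of_notMem hξ, zero_mul, sub_zero, norm_mul, norm_relSymbol]
        exact mul_le_mul_of_nonneg_right (htail _ h4 hξ) (norm_nonneg _)
    calc C * ‖mulSymbol A.isSymbol (h - mulSymbol hband h)‖
        ≤ C * (ε / (C + 1) * ‖h‖) := by gcongr
      _ = C / (C + 1) * (ε * ‖h‖) := by ring
      _ ≤ 1 * (ε * ‖h‖) := by
          gcongr
          rw [div_le_one (by positivity)]
          linarith
      _ = ε * ‖h‖ := one_mul _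
  · have hbd : ∀ᵐ ξ, ‖g ξ‖ ≤ R * ‖h ξ‖ := by
      filter_upwards [hgae] with ξ h1
      rw [h1, norm_mul]
      exact mul_le_mul_of_nonneg_right (hcb ξ) (norm_nonneg _)
    have hg2 : MemLp g 2 volume :=
      (Lp.memLp h).of_le_mul (integrable_conj_mul χ h).1 hbd
    obtain ⟨f₂, h1, -, h3⟩ := exists_isFourierTransform_of_memLp_two hg2
    rw [eLpNorm_congr_ae (hfm.left_unique h1), h3]
    refine (eLpNorm_le_mul_eLpNorm_of_ae_le_mul hbd 2).trans (le_of_eq ?_)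
    rw [ENNReal.ofReal_mul hR.le, Lp.norm_def, ENNReal.ofReal_toReal (Lp.eLpNorm_ne_top h)]

/-- Interpolation between `L^∞` and `L²`: `|F|^q ≤ c^(q - 2) |F|²`. -/
theorem eLpNorm_le_of_bound_of_eLpNorm_two_le {α : Type*} [MeasurableSpace α] {μ : Measure α}
    {F : α → ℂ} {c B : ℝ} (hq : 2 < q) (hc : 0 ≤ c) (hB : 0 ≤ B) (hFc : ∀ x, ‖F x‖ ≤ c)
    (hF2 : eLpNorm F 2 μ ≤ ENNReal.ofReal B) :
    eLpNorm F (ENNReal.ofReal q) μ ≤ ENNReal.ofReal ((c ^ (q - 2) * B ^ 2) ^ (1 / q)) := by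
  have hq0 : ENNReal.ofReal q ≠ 0 := by simpa using by linarith
  rw [eLpNorm_eq_lintegral_rpow_enorm_toReal hq0 ENNReal.ofReal_ne_top,
    ENNReal.toReal_ofReal (by linarith), ← ENNReal.ofReal_rpow_of_nonneg (by positivity)
      (by positivity)]
  refine ENNReal.rpow_le_rpow ?_ (by positivity)
  calc ∫⁻ x, ‖F x‖ₑ ^ q ∂μ ≤ ∫⁻ x, ENNReal.ofReal (c ^ (q - 2)) * ‖F x‖ₑ ^ 2 ∂μ := by
        refine lintegral_mono fun x => ?_
        rw [show q = (q - 2) + (2 : ℕ) by push_cast; ring,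
          ENNReal.rpow_add_of_nonneg _ _ (by linarith) (by norm_num), ENNReal.rpow_natCast]
        refine mul_le_mul_left ?_ _
        rw [← ofReal_norm, ENNReal.ofReal_rpow_of_nonneg (norm_nonneg _) (by linarith)]
        refine ENNReal.ofReal_le_ofReal ?_
        push_cast
        rw [add_sub_cancel_right]
        exact Real.rpow_le_rpow (norm_nonneg _) (hFc x) (by linarith)
    _ = ENNReal.ofReal (c ^ (q - 2)) * eLpNorm F 2 μ ^ 2 := by
        rw [lintegral_const_mul' _ _ ENNReal.ofReal_ne_top, eLpNorm_two_sq]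
    _ ≤ ENNReal.ofReal (c ^ (q - 2)) * ENNReal.ofReal B ^ 2 := by gcongr
    _ = _ := by rw [← ENNReal.ofReal_pow hB, ← ENNReal.ofReal_mul (by positivity)]

/-- A function in `Ḣ^1 ∩ Ḣ^s` that is not small in `L^q` concentrates around some point. -/
theorem Admissible.exists_concentration (A : Admissible d s σ q) (M : ℝ) {ε : ℝ≥0∞}
    (hε : 0 < ε) : ∃ (χ : L2 d) (c : ℝ), 0 < c ∧ ∀ (f : Rd d → ℂ) (h : L2 d), HasAmp s f h →
      ‖h‖ ≤ M → ε ≤ eLpNorm f (ENNReal.ofReal q) volume →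
      ∃ x, c ≤ ‖inner ℂ χ (shift x h)‖ := by
  obtain ⟨η, hη, hηε⟩ := ENNReal.lt_iff_exists_nnreal_btwn.1 hε
  have hη0 : (0 : ℝ) < η := by exact_mod_cast hη
  have hq := A.two_lt
  obtain ⟨χ, K, hK, happ⟩ := A.exists_band_approx (ε := η / (2 * (|M| + 1))) (by positivity)
  set B := K * (|M| + 1) with hB
  have hB0 : 0 ≤ B := by positivity
  -- Makes the interpolated `L^q` bound at most `η / 2`; the `+ 1` covers `B = 0`.
  set c := ((η / 2 : ℝ) ^ q / (B ^ 2 + 1)) ^ (1 / (q - 2)) with hc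
  have hc0 : 0 < c := by positivity
  have hcq : c ^ (q - 2) * B ^ 2 ≤ (η / 2 : ℝ) ^ q := by
    have : 1 / (q - 2) * (q - 2) = 1 := by
      have : q - 2 ≠ 0 := by linarith
      field_simp
    rw [hc, ← Real.rpow_mul (by positivity), this, Real.rpow_one, div_mul_eq_mul_div,
      div_le_iff₀ (by positivity)]
    have : 0 ≤ (η / 2 : ℝ) ^ q := by positivity
    nlinarith
  refine ⟨χ, c, hc0, fun f h hf hM hle => ?_⟩
  obtain ⟨h1, h2⟩ := happ f h hf
  by_contra hcon
  push Not at hcon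
  have hM' : ‖h‖ ≤ |M| + 1 := by linarith [le_abs_self M]
  have h3 := eLpNorm_le_of_bound_of_eLpNorm_two_le (q := q) hq hc0.le hB0 (fun x => (hcon x).le)
    (h2.trans (ENNReal.ofReal_le_ofReal (by rw [hB]; gcongr)))
  have h4 : (c ^ (q - 2) * B ^ 2) ^ (1 / q) ≤ η / 2 := by
    refine (Real.rpow_le_rpow (by positivity) hcq (by positivity)).trans (le_of_eq ?_)
    rw [← Real.rpow_mul (by positivity), mul_one_div_cancel (by linarith), Real.rpow_one]
  have h5 : (η / (2 * (|M| + 1)) : ℝ) * ‖h‖ ≤ η / 2 := by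
    calc (η / (2 * (|M| + 1)) : ℝ) * ‖h‖ ≤ η / (2 * (|M| + 1)) * (|M| + 1) := by gcongr
      _ = η / 2 := by field_simp
  have hmeas : AEStronglyMeasurable (fun x => inner ℂ χ (shift x h)) volume :=
    (continuous_inner_shift χ h).aestronglyMeasurable
  have hfm := IsFourierTransform.aestronglyMeasurable_left hf
  have h6 := eLpNorm_add_le (hfm.sub hmeas) hmeas A.one_le
  rw [sub_add_cancel] at h6
  have h7 : eLpNorm f (ENNReal.ofReal q) volume ≤ ENNReal.ofReal (η / 2) + ENNReal.ofReal (η / 2) :=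
    h6.trans (add_le_add (h1.trans (ENNReal.ofReal_le_ofReal h5))
      (h3.trans (ENNReal.ofReal_le_ofReal h4)))
  rw [← ENNReal.ofReal_add (by positivity) (by positivity), add_halves,
    ENNReal.ofReal_coe_nnreal] at h7
  exact absurd (hle.trans h7) (not_le.2 hηε)

/-- Weak convergence in `Ḣ^1 ∩ Ḣ^s` implies strong convergence in `L^q` on bounded sets. -/
theorem Admissible.tendsto_eLpNorm_restrict (A : Admissible d s σ q) {u : ℕ → L2 d} {C : ℝ}
    (hC : ∀ n, ‖u n‖ ≤ C) (hu : WeakLim atTop u 0) {f : ℕ → Rd d → ℂ}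
    (hf : ∀ n, HasAmp s (f n) (u n)) {S : Set (Rd d)} (hS : volume S ≠ ⊤) :
    Tendsto (fun n => eLpNorm (f n) (ENNReal.ofReal q) (volume.restrict S)) atTop (𝓝 0) := by
  have hC0 : 0 ≤ C := (norm_nonneg _).trans (hC 0)
  have hq := A.two_lt
  have hq0 : ENNReal.ofReal q ≠ 0 := by simpa using by linarith
  have : IsFiniteMeasure (volume.restrict S) := ⟨by
    rw [Measure.restrict_apply_univ]; exact hS.lt_top⟩
  rw [ENNReal.tendsto_nhds_zero]
  intro ε hε
  obtain ⟨η, hη, hηε⟩ := ENNReal.lt_iff_exists_nnreal_btwn.1 hε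
  have hη0 : (0 : ℝ) < η := by exact_mod_cast hη
  obtain ⟨χ, K, -, happ⟩ := A.exists_band_approx (ε := η / (2 * (C + 1))) (by positivity)
  -- Moving the translation onto `χ` turns weak convergence into pointwise convergence; the
  -- coefficients are uniformly bounded and `S` has finite measure, so dominated convergence
  -- applies.
  have hband : Tendsto (fun n => eLpNorm (fun x => inner ℂ χ (shift x (u n)))
      (ENNReal.ofReal q) (volume.restrict S)) atTop (𝓝 0) := by
    simp_rw [eLpNorm_eq_lintegral_rpow_enorm_toReal hq0 ENNReal.ofReal_ne_top,
      ENNReal.toReal_ofReal (by linarith : 0 ≤ q)]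
    have h1 : Tendsto (fun n => ∫⁻ x in S, ‖inner ℂ χ (shift x (u n))‖ₑ ^ q) atTop
        (𝓝 (∫⁻ _ in S, 0)) := by
      refine tendsto_lintegral_of_dominated_convergence
        (fun _ => ENNReal.ofReal (‖χ‖ * C) ^ q) (fun n => ?_) (fun n => ?_) ?_ ?_
      · have := (continuous_inner_shift χ (u n)).measurable
        fun_prop
      · refine Eventually.of_forall fun x => ENNReal.rpow_le_rpow ?_ (by linarith)
        rw [← ofReal_norm]
        refine ENNReal.ofReal_le_ofReal ((norm_inner_le_norm _ _).trans ?_)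
        rw [LinearIsometry.norm_map]
        exact mul_le_mul_of_nonneg_left (hC n) (norm_nonneg _)
      · rw [lintegral_const]
        exact ENNReal.mul_ne_top (ENNReal.rpow_ne_top_of_nonneg (by linarith)
          ENNReal.ofReal_ne_top) (measure_ne_top _ _)
      · refine Eventually.of_forall fun x => ?_
        have h2 : Tendsto (fun n => inner ℂ χ (shift x (u n))) atTop (𝓝 0) := by
          simp_rw [isMixingAction_shift.inner_right]
          simpa using hu (shift (-x) χ)
        have h3 := h2.enorm
        rw [enorm_zero] at h3
        have h4 := (ENNReal.continuous_rpow_const (y := q)).tendsto 0 |>.comp h3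
        rwa [ENNReal.zero_rpow_of_pos (by linarith)] at h4
    rw [lintegral_zero] at h1
    have h5 := (ENNReal.continuous_rpow_const (y := 1 / q)).tendsto 0 |>.comp h1
    rwa [ENNReal.zero_rpow_of_pos (by positivity)] at h5
  have hη2 : (0 : ℝ≥0∞) < ENNReal.ofReal (η / 2) := by simpa using hη0
  filter_upwards [hband.eventually_le_const hη2] with n hn
  have hmeas : AEStronglyMeasurable (fun x => inner ℂ χ (shift x (u n))) (volume.restrict S) :=
    (continuous_inner_shift χ (u n)).aestronglyMeasurable
  have hfm := (IsFourierTransform.aestronglyMeasurable_left (hf n)).restrict (s := S)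
  have h6 := eLpNorm_add_le (hfm.sub hmeas) hmeas A.one_le
  rw [sub_add_cancel] at h6
  have h5 : (η / (2 * (C + 1)) : ℝ) * ‖u n‖ ≤ η / 2 := by
    have := hC n
    calc (η / (2 * (C + 1)) : ℝ) * ‖u n‖ ≤ η / (2 * (C + 1)) * (C + 1) := by gcongr; linarith
      _ = η / 2 := by field_simp
  have h1 := (eLpNorm_mono_measure _ (Measure.restrict_le_self (s := S))).trans
    ((happ _ _ (hf n)).1.trans (ENNReal.ofReal_le_ofReal h5))
  refine (h6.trans (add_le_add h1 hn)).trans ?_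
  rw [← ENNReal.ofReal_add (by positivity) (by positivity), add_halves,
    ENNReal.ofReal_coe_nnreal]
  exact hηε.le

end

/-! ### The Brezis–Lieb splitting and reality of local limits. -/

section

variable {α : Type*} [MeasurableSpace α] {μ : Measure α} {q : ℝ}

theorem lpNorm_rpow_eq {F : α → ℂ} (hq : 0 < q) (hF : AEStronglyMeasurable F μ) :
    lpNorm F (ENNReal.ofReal q) μ ^ q = (∫⁻ x, ‖F x‖ₑ ^ q ∂μ).toReal := by
  have hq0 : ENNReal.ofReal q ≠ 0 := by simpa using hq
  rw [← toReal_eLpNorm hF, eLpNorm_eq_lintegral_rpow_enorm_toReal hq0 ENNReal.ofReal_ne_top,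
    ENNReal.toReal_ofReal hq.le, ← ENNReal.toReal_rpow, ← Real.rpow_mul ENNReal.toReal_nonneg,
    one_div_mul_cancel hq.ne', Real.rpow_one]

theorem lpNorm_rpow_restrict_add_compl {F : α → ℂ} (hq : 0 < q)
    (hF : MemLp F (ENNReal.ofReal q) μ) {S : Set α} (hS : MeasurableSet S) :
    lpNorm F (ENNReal.ofReal q) (μ.restrict S) ^ q +
      lpNorm F (ENNReal.ofReal q) (μ.restrict Sᶜ) ^ q = lpNorm F (ENNReal.ofReal q) μ ^ q := by
  have hq0 : ENNReal.ofReal q ≠ 0 := by simpa using hq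
  have h1 : ∫⁻ x, ‖F x‖ₑ ^ q ∂μ ≠ ⊤ := by
    have := lintegral_rpow_enorm_lt_top_of_eLpNorm_lt_top hq0 ENNReal.ofReal_ne_top hF.2
    rw [ENNReal.toReal_ofReal hq.le] at this
    exact this.ne
  rw [lpNorm_rpow_eq hq hF.1, lpNorm_rpow_eq hq hF.1.restrict, lpNorm_rpow_eq hq hF.1.restrict,
    ← ENNReal.toReal_add (ne_top_of_le_ne_top h1 (setLIntegral_le_lintegral _ _))
      (ne_top_of_le_ne_top h1 (setLIntegral_le_lintegral _ _)), lintegral_add_compl _ hS]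

theorem exists_abs_rpow_sub_rpow_le (hq : 0 ≤ q) (B : ℝ) {η : ℝ} (hη : 0 < η) :
    ∃ δ > 0, ∀ a b : ℝ, 0 ≤ a → a ≤ B → 0 ≤ b → b ≤ B → |a - b| < δ → |a ^ q - b ^ q| < η := by
  have h1 : UniformContinuousOn (fun t : ℝ => t ^ q) (Set.Icc 0 B) :=
    isCompact_Icc.uniformContinuousOn_of_continuous
      (Real.continuous_rpow_const hq).continuousOn
  obtain ⟨δ, hδ, h2⟩ := Metric.uniformContinuousOn_iff.1 h1 η hη
  exact ⟨δ, hδ, fun a b ha ha' hb hb' hab => h2 a ⟨ha, ha'⟩ b ⟨hb, hb'⟩ hab⟩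

theorem abs_lpNorm_add_sub_lpNorm_le {Q : ℝ≥0∞} (hQ : 1 ≤ Q) {F G : α → ℂ} (hF : MemLp F Q μ)
    (hG : MemLp G Q μ) :
    |lpNorm (fun x => F x + G x) Q μ - lpNorm G Q μ| ≤ lpNorm F Q μ := by
  have h1 : lpNorm (F + G) Q μ ≤ lpNorm F Q μ + lpNorm G Q μ := lpNorm_add_le hF hQ
  have h2 : lpNorm (F + G - F) Q μ ≤ lpNorm (F + G) Q μ + lpNorm F Q μ :=
    lpNorm_sub_le (hF.add hG) hQ
  rw [add_sub_cancel_left] at h2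
  change |lpNorm (F + G) Q μ - lpNorm G Q μ| ≤ _
  rw [abs_le]
  constructor <;> linarith

/-- The Brezis-Lieb splitting, for perturbations that are bounded in `L^q` and vanish locally. -/
theorem tendsto_lpNorm_add_rpow_sub (hq : 1 ≤ q) {φ : α → ℂ} {r : ℕ → α → ℂ}
    (hφ : MemLp φ (ENNReal.ofReal q) μ) (hr : ∀ n, MemLp (r n) (ENNReal.ofReal q) μ)
    {B : ℝ} (hB : ∀ n, lpNorm (r n) (ENNReal.ofReal q) μ ≤ B)
    (hloc : ∀ S, MeasurableSet S → μ S ≠ ⊤ →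
      Tendsto (fun n => eLpNorm (r n) (ENNReal.ofReal q) (μ.restrict S)) atTop (𝓝 0)) :
    Tendsto (fun n => lpNorm (fun x => φ x + r n x) (ENNReal.ofReal q) μ ^ q -
      lpNorm (r n) (ENNReal.ofReal q) μ ^ q) atTop (𝓝 (lpNorm φ (ENNReal.ofReal q) μ ^ q)) := by
  set Q := ENNReal.ofReal q with hQdef
  have hq0 : 0 < q := by linarith
  have hQ : 1 ≤ Q := by rw [hQdef, ENNReal.one_le_ofReal]; exact hq
  rw [Metric.tendsto_nhds]
  intro ε hε
  set B' := B + lpNorm φ Q μ with hB'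
  have hB0 : 0 ≤ B := lpNorm_nonneg.trans (hB 0)
  obtain ⟨δ, hδ, hrpow⟩ := exists_abs_rpow_sub_rpow_le (q := q) hq0.le B' (η := ε / 4)
    (by positivity)
  -- `S` carries `φ` up to `δ`: on `S` the perturbation is small, off `S` the function `φ` is. Each
  -- region costs two errors of `ε / 4`.
  obtain ⟨S, hS, hSfin, hSφ⟩ := hφ.exists_eLpNorm_indicator_compl_lt ENNReal.ofReal_ne_top
    (ε := ENNReal.ofReal δ) (by simpa using hδ)
  rw [eLpNorm_indicator_eq_eLpNorm_restrict hS.compl] at hSφ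
  have hφS : lpNorm φ Q (μ.restrict Sᶜ) < δ := by
    rw [← toReal_eLpNorm hφ.1.restrict]
    exact (ENNReal.toReal_lt_of_lt_ofReal hSφ)
  have hδ' : (0 : ℝ≥0∞) < ENNReal.ofReal δ := by simpa using hδ
  filter_upwards [(hloc S hS hSfin.ne).eventually_lt_const hδ'] with n hn
  have hrS : lpNorm (r n) Q (μ.restrict S) < δ := by
    rw [← toReal_eLpNorm (hr n).1.restrict]
    exact ENNReal.toReal_lt_of_lt_ofReal hn
  have hmono : ∀ {F : α → ℂ} (T : Set α), MemLp F Q μ →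
      lpNorm F Q (μ.restrict T) ≤ lpNorm F Q μ := by
    intro F T hF
    rw [← toReal_eLpNorm hF.1.restrict, ← toReal_eLpNorm hF.1]
    exact ENNReal.toReal_mono hF.2.ne (eLpNorm_mono_measure _ Measure.restrict_le_self)
  have hsum : MemLp (fun x => φ x + r n x) Q μ := hφ.add (hr n)
  have hle : lpNorm (fun x => φ x + r n x) Q μ ≤ B' := by
    refine (lpNorm_add_le hφ hQ).trans ?_
    linarith [hB n]
  have hrB : lpNorm (r n) Q μ ≤ B' := (hB n).trans (by
    have : 0 ≤ lpNorm φ Q μ := lpNorm_nonneg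
    linarith)
  have hφB : lpNorm φ Q μ ≤ B' := by linarith
  have e1 := hrpow _ _ lpNorm_nonneg ((hmono S hsum).trans hle) lpNorm_nonneg
    ((hmono S hφ).trans hφB) (by
      have := abs_lpNorm_add_sub_lpNorm_le (μ := μ.restrict S) hQ ((hr n).restrict S) (hφ.restrict S)
      simp only [add_comm (r n _)] at this
      exact this.trans_lt hrS)
  have e2 := hrpow _ _ lpNorm_nonneg ((hmono Sᶜ hsum).trans hle) lpNorm_nonneg
    ((hmono Sᶜ (hr n)).trans hrB)
    ((abs_lpNorm_add_sub_lpNorm_le (μ := μ.restrict Sᶜ) hQ (hφ.restrict Sᶜ)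
      ((hr n).restrict Sᶜ)).trans_lt hφS)
  have hB'0 : 0 ≤ B' := lpNorm_nonneg.trans hφB
  have e3 := hrpow _ 0 lpNorm_nonneg ((hmono S (hr n)).trans hrB) le_rfl hB'0
    (by rwa [sub_zero, abs_of_nonneg lpNorm_nonneg])
  have e4 := hrpow _ 0 lpNorm_nonneg ((hmono Sᶜ hφ).trans hφB) le_rfl hB'0
    (by rwa [sub_zero, abs_of_nonneg lpNorm_nonneg])
  rw [Real.zero_rpow hq0.ne', sub_zero] at e3 e4
  rw [Real.dist_eq, ← lpNorm_rpow_restrict_add_compl hq0 hsum hS,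
    ← lpNorm_rpow_restrict_add_compl hq0 hφ hS, ← lpNorm_rpow_restrict_add_compl hq0 (hr n) hS]
  rw [abs_lt] at *
  constructor <;> linarith

/-- If `φ + r n` is real and `r n` vanishes locally in the limit, then `φ` is real. -/
theorem ae_im_eq_zero_of_tendsto [SigmaFinite μ] {Q : ℝ≥0∞} (hQ : Q ≠ 0) {φ : α → ℂ}
    {r : ℕ → α → ℂ} (hφ : AEStronglyMeasurable φ μ)
    (hreal : ∀ n, ∀ᵐ x ∂μ, (φ x + r n x).im = 0)
    (hloc : ∀ S, MeasurableSet S → μ S ≠ ⊤ →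
      Tendsto (fun n => eLpNorm (r n) Q (μ.restrict S)) atTop (𝓝 0)) :
    ∀ᵐ x ∂μ, (φ x).im = 0 := by
  have h1 : ∀ k : ℕ, ∀ᵐ x ∂(μ.restrict (spanningSets μ k)), (φ x).im = 0 := by
    intro k
    have h2 := hloc _ (measurableSet_spanningSets μ k) (measure_spanningSets_lt_top μ k).ne
    have h3 : eLpNorm (fun x => (φ x).im) Q (μ.restrict (spanningSets μ k)) ≤ 0 := by
      refine ge_of_tendsto h2 (Eventually.of_forall fun n => eLpNorm_mono_ae ?_)
      filter_upwards [ae_restrict_of_ae (hreal n)] with x hx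
      rw [Complex.add_im] at hx
      rw [eq_neg_of_add_eq_zero_left hx, norm_neg, Real.norm_eq_abs]
      exact Complex.abs_im_le_norm _
    have him : AEStronglyMeasurable (fun x => (φ x).im) (μ.restrict (spanningSets μ k)) :=
      Complex.continuous_im.comp_aestronglyMeasurable hφ.restrict
    exact (eLpNorm_eq_zero_iff him hQ).1 (le_antisymm h3 zero_le)
  have h4 : ∀ᵐ x ∂μ, ∀ k, x ∈ spanningSets μ k → (φ x).im = 0 :=
    ae_all_iff.2 fun k => (ae_restrict_iff' (measurableSet_spanningSets μ k)).1 (h1 k)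
  filter_upwards [h4] with x hx
  exact hx _ (mem_spanningSetsIndex μ x)

end

/-- Telescoping: decoupling one profile at a time decouples any finite number. -/
theorem tendsto_sub_sum_of_steps {a : ℕ → ℕ → ℝ} {b : ℕ → ℝ}
    (h : ∀ J, Tendsto (fun n => a J n - a (J + 1) n) atTop (𝓝 (b (J + 1)))) (J : ℕ) :
    Tendsto (fun n => a 0 n - ((∑ j ∈ Finset.Icc 1 J, b j) + a J n)) atTop (𝓝 0) := by
  induction J with
  | zero => simp
  | succ J ih =>
    have h1 := ih.add ((h J).sub_const (b (J + 1)))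
    rw [sub_self, add_zero] at h1
    refine h1.congr fun n => ?_
    rw [Finset.sum_Icc_succ_top (by omega)]
    ring

/-! ### From amplitudes back to functions, and the exponents. -/

section

variable {d : ℕ} {s σ q : ℝ}

/-- The adjoint moves `T` onto the test vector. With `T` a multiplier, weak limits of amplitudes
pass to each Sobolev norm. -/
theorem WeakLim.map {H : Type*} [NormedAddCommGroup H] [InnerProductSpace ℂ H] [CompleteSpace H]
    {l : Filter ℕ} {u : ℕ → H} {φ : H} (hu : WeakLim l u φ) (T : H →L[ℂ] H) :
    WeakLim l (fun n => T (u n)) (T φ) := by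
  intro k
  simpa only [ContinuousLinearMap.adjoint_inner_left] using hu (T.adjoint k)

/-- Weak convergence of the amplitudes implies weak convergence in `Ḣ^1 ∩ Ḣ^s`. -/
theorem Admissible.weakTendsto_zero (A : Admissible d s σ q) {u : ℕ → L2 d} {f : ℕ → Rd d → ℂ}
    (hf : ∀ n, HasAmp s (f n) (u n)) (hu : WeakLim atTop u 0) : WeakTendsto s f 0 := by
  have hs1 : s ≤ 1 := A.s_lt.le.trans A.lt_one.le
  refine ⟨fun n => (hf n).memX A.s_nonneg hs1, (hasAmp_zero s).memX A.s_nonneg hs1, ?_⟩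
  rintro ℓ ⟨C, hC⟩
  have hbd : ∀ (f : Rd d → ℂ) (h : L2 d), HasAmp s f h → ‖ℓ f‖ ≤ 2 * |C| * ‖h‖ := by
    intro f h hfh
    refine (hC f (hfh.memX A.s_nonneg hs1)).trans ?_
    rw [hfh.hdotNorm_eq (isSymbol_relSymbol A.s_nonneg hs1 le_rfl),
      hfh.hdotNorm_eq (isSymbol_relSymbol A.s_nonneg le_rfl hs1)]
    have h1 := norm_mulSymbol_le (isSymbol_relSymbol A.s_nonneg hs1 le_rfl) h
    have h2 := norm_mulSymbol_le (isSymbol_relSymbol A.s_nonneg le_rfl hs1) h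
    calc C * (‖mulSymbol (isSymbol_relSymbol A.s_nonneg hs1 le_rfl) h‖ +
          ‖mulSymbol (isSymbol_relSymbol A.s_nonneg le_rfl hs1) h‖)
        ≤ |C| * (‖h‖ + ‖h‖) := by
          gcongr
          exact le_abs_self C
      _ = 2 * |C| * ‖h‖ := by ring
  -- `ℓ` acts on functions rather than classes; its bound makes it blind to the representative.
  have huniq : ∀ (f f' : Rd d → ℂ) (h : L2 d), HasAmp s f h → HasAmp s f' h → ℓ f = ℓ f' := by
    intro f f' h h1 h2
    have h3 := hbd _ _ (h1.sub h2)
    rw [sub_self, norm_zero, mul_zero] at h3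
    have h4 : ℓ (f - f') = 0 := norm_le_zero_iff.1 h3
    rwa [map_sub, sub_eq_zero] at h4
  -- The chosen representatives need not be linear in the amplitude, but `ℓ` of them is, by `huniq`;
  -- Riesz then represents it.
  choose S hS using A.exists_hasAmp
  let L : L2 d →L[ℂ] ℂ := LinearMap.mkContinuous
    { toFun := fun h => ℓ (S h)
      map_add' := fun h k => by
        rw [← map_add]
        exact huniq _ _ _ (hS _) ((hS h).add (hS k))
      map_smul' := fun c h => by
        rw [RingHom.id_apply, ← map_smul]
        exact huniq _ _ _ (hS _) ((hS h).const_smul c) }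
    (2 * |C|) fun h => hbd _ _ (hS h)
  have hL : ∀ n, ℓ (f n) = inner ℂ ((InnerProductSpace.toDual ℂ (L2 d)).symm L) (u n) := by
    intro n
    rw [InnerProductSpace.toDual_symm_apply]
    exact huniq _ _ _ (hf n) (hS _)
  simp_rw [hL]
  have := hu ((InnerProductSpace.toDual ℂ (L2 d)).symm L)
  rwa [inner_zero_right, ← map_zero ℓ] at this

theorem lpNorm_comp_add_right (f : Rd d → ℂ) (Q : ℝ≥0∞) (a : Rd d)
    (hf : AEStronglyMeasurable f) :
    lpNorm (fun x => f (x + a)) Q volume = lpNorm f Q volume := by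
  have hmp := measurePreserving_add_right (volume : Measure (Rd d)) a
  refine (toReal_eLpNorm (hf.comp_measurePreserving hmp)).symm.trans
    (Eq.trans ?_ (toReal_eLpNorm hf))
  congr 1
  exact eLpNorm_comp_measurePreserving hf hmp

/-- `0 ≤ s` amounts to `4 ≤ p d`, while `s < σ` and `σ < 1` both amount to `(d - 2) p < 4`. -/
theorem admissible_of_exponents (hd : 2 ≤ d) {p : ℝ} (hp : 4 / (d : ℝ) ≤ p)
    (hp' : 2 < d → p < 4 / ((d : ℝ) - 2)) (hs : s = (d : ℝ) / 2 - 2 / p) :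
    Admissible d s ((d : ℝ) / 2 - d / (p + 2)) (p + 2) := by
  have hd' : (2 : ℝ) ≤ d := by exact_mod_cast hd
  have hp0 : 0 < p := lt_of_lt_of_le (by positivity) hp
  have h4 : 4 ≤ p * d := (div_le_iff₀ (by positivity)).1 hp
  have hlt : ((d : ℝ) - 2) * p < 4 := by
    rcases Nat.eq_or_lt_of_le hd with h | h
    · rw [← h]; norm_num
    · have h2 : (2 : ℝ) < d := by exact_mod_cast h
      have := hp' h
      rw [lt_div_iff₀ (by linarith)] at this
      linarith
  refine ⟨by omega, ?_, ?_, ?_, by linarith, rfl⟩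
  · rw [hs, sub_nonneg, div_le_div_iff₀ hp0 (by norm_num)]
    linarith
  · rw [hs, sub_lt_sub_iff_left, div_lt_div_iff₀ (by linarith) hp0]
    linarith
  · have : (d : ℝ) / 2 - 1 < d / (p + 2) := by
      rw [lt_div_iff₀ (by linarith)]
      linarith
    linarith

end

end Bubble

end

/-! ### Assembly of the profile decomposition. -/

theorem theoremT (d : ℕ) (hd : 2 ≤ d) (p s : ℝ) (hp : 4 / (d : ℝ) ≤ p)
    (hp' : 2 < d → p < 4 / ((d : ℝ) - 2)) (hs : s = (d : ℝ) / 2 - 2 / p)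
    (f : ℕ → Bubble.Rd d → ℂ) (hf : ∀ n, Bubble.MemX s (f n))
    (hbdd : ∃ M : ℝ, ∀ n, Bubble.hdotNorm 1 (f n) ≤ M ∧ Bubble.hdotNorm s (f n) ≤ M) :
    ∃ (Jstar : ℕ∞) (φ : ℕ → Bubble.Rd d → ℂ) (x : ℕ → ℕ → Bubble.Rd d) (σ : ℕ → ℕ)
      (r : ℕ → ℕ → Bubble.Rd d → ℂ),
      StrictMono σ ∧
      -- the profiles are nonzero elements of the space, real-valued if all `f n` are
      (∀ j : ℕ, 1 ≤ j → (j : ℕ∞) ≤ Jstar →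
        Bubble.MemX s (φ j) ∧ ¬ (φ j =ᵐ[volume] 0) ∧
        MemLp (φ j) (ENNReal.ofReal (p + 2)) volume ∧
        ((∀ n, ∀ᵐ y, (f n y).im = 0) → ∀ᵐ y, (φ j y).im = 0)) ∧
      -- the remainders `r J n` lie in the space
      (∀ J : ℕ, (J : ℕ∞) < Jstar + 1 → ∀ n,
        Bubble.MemX s (r J n) ∧ MemLp (r J n) (ENNReal.ofReal (p + 2)) volume) ∧
      -- decomposition
      (∀ J : ℕ, (J : ℕ∞) < Jstar + 1 → ∀ n y,
        f (σ n) y = (∑ j ∈ Finset.Icc 1 J, φ j (y - x j n)) + r J n y) ∧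
      -- weak convergence of the translated remainders
      (∀ J : ℕ, 1 ≤ J → (J : ℕ∞) < Jstar + 1 →
        Bubble.WeakTendsto s (fun n y => r J n (y + x J n)) 0) ∧
      -- the remainders vanish in `L^{p+2}`
      Tendsto (fun J : ℕ =>
          limsup (fun n => eLpNorm (r J n) (ENNReal.ofReal (p + 2)) volume) atTop)
        (Bubble.toJstar Jstar) (𝓝 0) ∧
      -- decoupling of the norms
      (∀ J : ℕ, (J : ℕ∞) < Jstar + 1 →
        Tendsto (fun n => Bubble.hdotNorm 1 (f (σ n)) ^ 2 -
          ((∑ j ∈ Finset.Icc 1 J, Bubble.hdotNorm 1 (φ j) ^ 2) + Bubble.hdotNorm 1 (r J n) ^ 2))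
          atTop (𝓝 0) ∧
        Tendsto (fun n => Bubble.hdotNorm s (f (σ n)) ^ 2 -
          ((∑ j ∈ Finset.Icc 1 J, Bubble.hdotNorm s (φ j) ^ 2) + Bubble.hdotNorm s (r J n) ^ 2))
          atTop (𝓝 0) ∧
        Tendsto (fun n => lpNorm (f (σ n)) (ENNReal.ofReal (p + 2)) volume ^ (p + 2) -
          ((∑ j ∈ Finset.Icc 1 J, lpNorm (φ j) (ENNReal.ofReal (p + 2)) volume ^ (p + 2)) +
            lpNorm (r J n) (ENNReal.ofReal (p + 2)) volume ^ (p + 2)))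
          atTop (𝓝 0)) ∧
      -- asymptotic orthogonality
      (∀ j j' : ℕ, 1 ≤ j → (j : ℕ∞) ≤ Jstar → 1 ≤ j' → (j' : ℕ∞) ≤ Jstar → j ≠ j' →
        Tendsto (fun n => ‖x j n - x j' n‖) atTop atTop) := by
  have A := Bubble.admissible_of_exponents hd hp hp' hs
  have hs1 : s ≤ 1 := A.s_lt.le.trans A.lt_one.le
  have hq0 : ENNReal.ofReal (p + 2) ≠ 0 := by simpa using by linarith [A.two_lt]
  have : Fact ((2 : ℝ≥0∞) ≠ ⊤) := ⟨by norm_num⟩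
  -- amplitudes of the given sequence
  obtain ⟨M, hM⟩ := hbdd
  choose h hfh hhn using fun n => (hf n).exists_hasAmp A.one_le_dim
  have hhb : ∃ C, ∀ n, ‖h n‖ ≤ C := ⟨M + M, fun n => (hhn n).trans (add_le_add (hM n).1 (hM n).2)⟩
  -- Representatives of one amplitude agree almost everywhere, so the `L^{p+2}` norm of `S h` is
  -- intrinsic to `h`.
  choose S hS using A.exists_hasAmp
  obtain ⟨Jstar, Φ, X, σ, R, hσ, hne, hR0, hRs, hRb, hRw, hRN, horth⟩ :=
    Bubble.exists_hilbert_profile_decomposition Bubble.isMixingAction_shift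
      (fun h => eLpNorm (S h) (ENNReal.ofReal (p + 2)) volume)
      (fun M ε hε => by
        obtain ⟨χ, c, hc, hχ⟩ := A.exists_concentration M hε
        exact ⟨χ, c, hc, fun h => hχ _ h (hS h)⟩) hhb
  -- Defined by pointwise subtraction, so that the decomposition holds at every point and not just
  -- almost everywhere.
  let r : ℕ → ℕ → Bubble.Rd d → ℂ := fun J n y =>
    f (σ n) y - ∑ j ∈ Finset.Icc 1 J, S (Φ j) (y - X j n)
  have hr0 : ∀ n, r 0 n = f (σ n) := fun n => by ext y; simp [r]
  have hrs : ∀ J n y, r (J + 1) n y = r J n y - S (Φ (J + 1)) (y - X (J + 1) n) := by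
    intro J n y
    simp only [r]
    rw [Finset.sum_Icc_succ_top (by omega)]
    ring
  have hramp : ∀ J n, Bubble.HasAmp s (r J n) (R J n) := by
    intro J n
    induction J with
    | zero => rw [hr0, hR0]; exact hfh _
    | succ J ih =>
      rw [hRs]
      have := ih.sub ((hS (Φ (J + 1))).translate (-(X (J + 1) n)))
      refine this.congr (Eventually.of_forall fun y => ?_)
      simp only [hrs, sub_eq_add_neg]
  -- one step of the decomposition, in the moving frame
  have hwamp : ∀ J n, Bubble.HasAmp s (fun y => r (J + 1) n (y + X (J + 1) n))
      (Bubble.shift (X (J + 1) n) (R (J + 1) n)) := fun J n => (hramp _ n).translate _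
  have hsplit : ∀ J n y, r J n (y + X (J + 1) n) =
      S (Φ (J + 1)) y + r (J + 1) n (y + X (J + 1) n) := by
    intro J n y
    rw [hrs, add_sub_cancel_right]
    ring
  have hrLp : ∀ J n, MemLp (r J n) (ENNReal.ofReal (p + 2)) volume := fun J n =>
    A.memLp (hramp J n)
  have hloc : ∀ J T, volume T ≠ ⊤ →
      Tendsto (fun n => eLpNorm (fun y => r (J + 1) n (y + X (J + 1) n)) (ENNReal.ofReal (p + 2))
        (volume.restrict T)) atTop (𝓝 0) := by
    intro J T hT
    obtain ⟨C, hC⟩ := hRb (J + 1)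
    exact A.tendsto_eLpNorm_restrict (C := C) (by simpa using hC) (hRw J) (hwamp J) hT
  -- decoupling
  have hdot : ∀ t : ℝ, Bubble.IsSymbol (Bubble.relSymbol t s : Bubble.Rd d → ℂ) → ∀ J,
      Tendsto (fun n => Bubble.hdotNorm t (f (σ n)) ^ 2 -
        ((∑ j ∈ Finset.Icc 1 J, Bubble.hdotNorm t (S (Φ j)) ^ 2) +
          Bubble.hdotNorm t (r J n) ^ 2)) atTop (𝓝 0) := by
    intro t ht J
    have hstep : ∀ J, Tendsto (fun n => Bubble.hdotNorm t (r J n) ^ 2 -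
        Bubble.hdotNorm t (r (J + 1) n) ^ 2) atTop (𝓝 (Bubble.hdotNorm t (S (Φ (J + 1))) ^ 2)) := by
      intro J
      have h1 : Bubble.WeakLim atTop (fun n => Bubble.shift (X (J + 1) n) (R J n))
          (Φ (J + 1)) := by
        intro k
        have h2 := (hRw J k).add_const (inner ℂ k (Φ (J + 1)))
        rw [inner_zero_right, zero_add] at h2
        refine h2.congr fun n => ?_
        dsimp only
        rw [hRs, map_sub, Bubble.isMixingAction_shift.neg_apply, inner_sub_right,
          sub_add_cancel]
      -- The multiplier commutes with translations, so the weighted amplitudes have the same weak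
      -- limits in the same frames and Pythagoras applies to this norm.
      have h3 := h1.map (Bubble.mulSymbol ht)
      simp_rw [Bubble.mulSymbol_shift] at h3
      have h4 := Bubble.norm_sq_sub_of_weakLim Bubble.isMixingAction_shift h3
      rw [(hS (Φ (J + 1))).hdotNorm_eq ht]
      refine h4.congr fun n => ?_
      rw [(hramp J n).hdotNorm_eq ht, (hramp (J + 1) n).hdotNorm_eq ht, hRs, map_sub,
        Bubble.mulSymbol_shift]
    have := Bubble.tendsto_sub_sum_of_steps
      (b := fun j => Bubble.hdotNorm t (S (Φ j)) ^ 2) hstep J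
    simpa only [hr0] using this
  have hlp : ∀ J, Tendsto (fun n => lpNorm (f (σ n)) (ENNReal.ofReal (p + 2)) volume ^ (p + 2) -
      ((∑ j ∈ Finset.Icc 1 J, lpNorm (S (Φ j)) (ENNReal.ofReal (p + 2)) volume ^ (p + 2)) +
        lpNorm (r J n) (ENNReal.ofReal (p + 2)) volume ^ (p + 2))) atTop (𝓝 0) := by
    intro J
    have hstep : ∀ J, Tendsto (fun n =>
        lpNorm (r J n) (ENNReal.ofReal (p + 2)) volume ^ (p + 2) -
          lpNorm (r (J + 1) n) (ENNReal.ofReal (p + 2)) volume ^ (p + 2)) atTop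
        (𝓝 (lpNorm (S (Φ (J + 1))) (ENNReal.ofReal (p + 2)) volume ^ (p + 2))) := by
      intro J
      obtain ⟨C, hC0, hC⟩ := A.exists_eLpNorm_le
      obtain ⟨B, hB⟩ := hRb (J + 1)
      -- Brezis–Lieb in the frame moved by `X (J + 1) n`, where the new remainder vanishes locally.
      have h1 := Bubble.tendsto_lpNorm_add_rpow_sub (q := p + 2) (by linarith [A.two_lt])
        (A.memLp (hS (Φ (J + 1)))) (fun n => A.memLp (hwamp J n)) (B := C * B) (fun n => by
          rw [← toReal_eLpNorm (A.memLp (hwamp J n)).1]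
          refine (ENNReal.toReal_le_of_le_ofReal (by positivity) (hC _ _ (hwamp J n))).trans ?_
          refine mul_le_mul_of_nonneg_left ((Bubble.norm_mulSymbol_le _ _).trans ?_) hC0
          rw [LinearIsometry.norm_map]
          exact hB n) (fun T _ hT => hloc J T hT)
      refine h1.congr fun n => ?_
      rw [Bubble.lpNorm_comp_add_right _ _ _ (hrLp (J + 1) n).1]
      simp_rw [← hsplit]
      rw [Bubble.lpNorm_comp_add_right _ _ _ (hrLp J n).1]
    have := Bubble.tendsto_sub_sum_of_steps
      (b := fun j => lpNorm (S (Φ j)) (ENNReal.ofReal (p + 2)) volume ^ (p + 2)) hstep J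
    simpa only [hr0] using this
  -- real profiles
  have hreal : (∀ n, ∀ᵐ y, (f n y).im = 0) →
      ∀ J, (∀ n, ∀ᵐ y, (r J n y).im = 0) ∧ ∀ᵐ y, (S (Φ (J + 1)) y).im = 0 := by
    intro hfr J
    -- A real remainder has a real next profile, and subtracting its translate keeps the remainder
    -- real.
    have hΦ : ∀ J, (∀ n, ∀ᵐ y, (r J n y).im = 0) → ∀ᵐ y, (S (Φ (J + 1)) y).im = 0 := by
      intro J hJ
      refine Bubble.ae_im_eq_zero_of_tendsto hq0 (A.memLp (hS (Φ (J + 1)))).1 (fun n => ?_)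
        (fun T _ hT => hloc J T hT)
      simp_rw [← hsplit]
      exact (measurePreserving_add_right (volume : Measure (Bubble.Rd d))
        (X (J + 1) n)).quasiMeasurePreserving.ae (hJ n)
    have hrr : ∀ n, ∀ᵐ y, (r J n y).im = 0 := by
      induction J with
      | zero => intro n; rw [hr0]; exact hfr _
      | succ J ih =>
        intro n
        filter_upwards [ih n, (measurePreserving_sub_right (volume : Measure (Bubble.Rd d))
          (X (J + 1) n)).quasiMeasurePreserving.ae (hΦ J ih)] with y h1 h2
        rw [hrs, Complex.sub_im, h1, h2, sub_zero]
    exact ⟨hrr, hΦ J hrr⟩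
  refine ⟨Jstar, fun j => S (Φ j), X, σ, r, hσ, fun j h1 h2 => ⟨(hS _).memX A.s_nonneg hs1,
    fun h0 => hne j h1 h2 ((hS _).eq_zero_of_ae_eq_zero A.one_le_dim h0), A.memLp (hS _),
    fun hfr => ?_⟩, fun J _ n => ⟨(hramp J n).memX A.s_nonneg hs1, hrLp J n⟩,
    fun J _ n y => by simp only [r]; ring, fun J h1 _ => ?_, ?_,
    fun J _ => ⟨hdot 1 (Bubble.isSymbol_relSymbol A.s_nonneg hs1 le_rfl) J,
      hdot s (Bubble.isSymbol_relSymbol A.s_nonneg le_rfl hs1) J, hlp J⟩, horth⟩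
  · have := (hreal hfr (j - 1)).2
    rwa [Nat.sub_add_cancel h1] at this
  · obtain ⟨J, rfl⟩ : ∃ k, J = k + 1 := ⟨J - 1, by omega⟩
    exact A.weakTendsto_zero (hwamp J) (hRw J)
  · refine hRN.congr fun J => ?_
    congr 1
    ext n
    exact eLpNorm_congr_ae ((hS _).ae_eq (hramp J n))
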